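/- Let $(b_j)_{j\ge 0}$ be real numbers with $b_j\ge 0$ for $j\ne 1$ and $0<-b_1=\sum_{j\ne 1}b_j<\infty$, and let $\mathcal N\subset\mathbb Z_+$ be a finite set with $1\notin\mathcal N$ and $b_k>0$ for all $k\in\mathcal N$. Write $\mathbf e_n$ $(n\in\mathcal N)$ for the unit vectors of $\mathbb Z_+^{\mathcal N}$, and $$B_{\mathcal N}(u,\mathbf v)=\sum_{j\in\mathcal N}b_jv_ju^j,\qquad \bar B_{\mathcal N}(u)=\sum_{j\notin\mathcal N}b_ju^j .$$ Let $(X,\mathbf Y)$ be the continuous-time Markov chain on $\mathbb Z_+\times\mathbb Z_+^{\mathcal N}$ with $Q$-matrix $$q_{(i,\mathbf k),(j,\mathbf l)}=\begin{cases} i\,b_{j-i+1}, & i\ge 1,\ j\ge i-1,\ j-i+1\notin\mathcal N,\ \mathbf l=\mathbf k,\\ i\,b_{j-i+1}, & i\ge 1,\ j\ge i-1,\ j-i+1\in\mathcal N,\ \mathbf l=\mathbf k+\mathbf e_{j-i+1},\\ 0,&\text{otherwise,}\end{cases}$$ so that $X$ is a Markov branching process and $Y_k(t)$ counts the jumps of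 $X$ of size $k-1$ up to time $t$. As usual the process is assumed regular, that is, its transition function $p_{x,y}(t)$, $t\ge0$, is an honest ($\sum_y p_{x,y}(t)=1$) standard transition function satisfying the Kolmogorov forward equations $p_{x,y}'(t)=\sum_z p_{x,z}(t)q_{z,y}$ for all states $x,y$ and all $t\ge 0$. Put $g_{j,\mathbf k}(t)=p_{(1,\mathbf 0),(j,\mathbf k)}(t)$. For $i\ge 0$ let $g^{*(i)}_{j,\mathbf k}(t)=\sum g_{l_1,\mathbf k_1}(t)\cdots g_{l_i,\mathbf k_i}(t)$, the sum being over all $(l_1,\mathbf k_1),\dots,(l_i,\mathbf k_i)$ in $\mathbb Z_+\times\mathbb Z_+^{\mathcal N}$ with sum $(j,\mathbf k)$ (so $g^{*(0)}_{j,\mathbf k}=\delta_{(j,\mathbf k),(0,\mathbf 0)}$), put $g^{*(i)}_{j,\mathbf k}=0$ if $\mathbf k\notin\mathbb Z_+^{\mathcal N}$, and let $$F_{j,\mathbf k}(t)=\sum_{i\in\mathcal N}b_i\,g^{*(i)}_{j,\mathbf k-\mathbf e_i}(t)+\sum_{i\notin\mathcal N}b_i\sum_{\substack{(l_1,\mathbf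 k_1)+\cdots+(l_i,\mathbf k_i)=(j,\mathbf k)\\ (l_m,\mathbf k_m)\ne(j,\mathbf k)\ \text{for all } m}}g_{l_1,\mathbf k_1}(t)\cdots g_{l_i,\mathbf k_i}(t).$$ **Theorem.** The series in $F_{j,\mathbf k}(t)$ converges absolutely for all $t\ge 0$, and the expression for $F_{j,\mathbf k}(t)$ involves only those $g_{l,\mathbf m}(t)$ with $(l,\mathbf m)\le(j,\mathbf k)$ componentwise and $(l,\mathbf m)\neq(j,\mathbf k)$. Hence the following formulas determine all $g_{j,\mathbf k}$ recursively. (i) If $0\notin\mathcal N$ and $b_0>0$, then $g_{0,\mathbf 0}(t)=G(t,0,\mathbf 0)$ for all $t\ge0$, where $y(t)=G(t,u,\mathbf v)$ denotes the unique $[0,1]$-valued solution on $[0,\infty)$ of $y'=B_{\mathcal N}(y,\mathbf v)+\bar B_{\mathcal N}(y)$, $y(0)=u$ (existence and uniqueness for $u=0$, $\mathbf v=\mathbf 0$ being part of the assertion). Moreover $\bar B_{\mathcal N}(g_{0,\mathbf 0}(t))>0$ for all $t\ge0$, and for all $(j,\mathbf k)\ne(0,\mathbf 0)$ and $t\ge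 0$ the integrand below is integrable on $[0,t]$ and $$g_{j,\mathbf k}(t)=\bar B_{\mathcal N}(g_{0,\mathbf 0}(t))\left[\delta_{j,1}\delta_{\mathbf k,\mathbf 0}\,b_0^{-1}+\int_0^t\frac{F_{j,\mathbf k}(s)}{\bar B_{\mathcal N}(g_{0,\mathbf 0}(s))}\,ds\right].$$ (ii) If $0\in\mathcal N$, then $g_{0,\mathbf 0}(t)=0$ for all $t\ge 0$, and for all $(j,\mathbf k)\ne(0,\mathbf 0)$ and $t\ge0$ the integrand below is integrable on $[0,t]$ and $$g_{j,\mathbf k}(t)=e^{b_1t}\left[\delta_{j,1}\delta_{\mathbf k,\mathbf 0}+\int_0^tF_{j,\mathbf k}(s)e^{-b_1s}\,ds\right].$$ -/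

import Mathlib

open MeasureTheory Set Filter Topology

namespace CrossingMBP

/-- The rates of a Markov branching process: `b j ≥ 0` for `j ≠ 1` and
`0 < -b 1 = ∑_{j ≠ 1} b j < ∞`. -/
structure IsBranchingRates (b : ℕ → ℝ) : Prop where
  nonneg : ∀ j, j ≠ 1 → 0 ≤ b j
  neg_one : 0 < -b 1
  hasSum : HasSum (fun j => if j = 1 then 0 else b j) (-b 1)

/-- The state space `ℤ₊ × ℤ₊^𝒩` of the augmented chain `(X, Y)`, where `Y = (Y_k)_{k ∈ 𝒩}`.
Addition and order are componentwise. -/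
abbrev State (N : Finset ℕ) : Type := ℕ × (N → ℕ)

/-- The `Q`-matrix of the augmented chain. From `(i, k)` with `i ≥ 1` the chain moves at rate
`i * b n` to `(i + n - 1, k + e_n)` if `n ∈ 𝒩`, and to `(i + n - 1, k)` if `n ∉ 𝒩`; for `n = 1`
(which is never in `𝒩`) this is the diagonal entry `i * b 1`. All other entries are zero. -/
def augQ (b : ℕ → ℝ) (N : Finset ℕ) (x y : State N) : ℝ :=
  if 1 ≤ x.1 ∧ x.1 ≤ y.1 + 1 then
    if h : y.1 + 1 - x.1 ∈ N then
      if y.2 = x.2 + Pi.single ⟨y.1 + 1 - x.1, h⟩ 1 then x.1 * b (y.1 + 1 - x.1) else 0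
    else
      if y.2 = x.2 then x.1 * b (y.1 + 1 - x.1) else 0
  else 0

/-- `P t x y`, `t ≥ 0`, is an honest standard transition function on the discrete state
space `α`. -/
structure IsTransitionFunction {α : Type} (P : ℝ → α → α → ℝ) : Prop where
  nonneg : ∀ t, 0 ≤ t → ∀ x y, 0 ≤ P t x y
  hasSum_one : ∀ t, 0 ≤ t → ∀ x, HasSum (P t x) 1
  zero_diag : ∀ x, P 0 x x = 1
  zero_offdiag : ∀ x y, x ≠ y → P 0 x y = 0
  chapman_kolmogorov : ∀ s t, 0 ≤ s → 0 ≤ t → ∀ x y,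
    HasSum (fun z => P s x z * P t z y) (P (s + t) x y)
  standard : ∀ x, Tendsto (fun t => P t x x) (𝓝[>] 0) (𝓝 1)

/-- `P` is the transition function of a continuous-time Markov chain governed by the `Q`-matrix
`Q`: an honest standard transition function with `p'_{xy}(t) = ∑_z p_{xz}(t) q_{zy}` for
all `t ≥ 0` (one-sided derivative at `t = 0`; in particular `P'(0) = Q`). -/
structure IsMarkovChainWithQ {α : Type} (Q : α → α → ℝ) (P : ℝ → α → α → ℝ) : Prop
    extends IsTransitionFunction P where
  summable_forward : ∀ t, 0 ≤ t → ∀ x y, Summable (fun z => P t x z * Q z y)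
  forward : ∀ t, 0 ≤ t → ∀ x y,
    HasDerivWithinAt (fun s => P s x y) (∑' z, P t x z * Q z y) (Ici 0) t

/-- `B_𝒩(u, v) = ∑_{j ∈ 𝒩} b_j v_j u^j`. -/
noncomputable def BN (b : ℕ → ℝ) (N : Finset ℕ) (u : ℝ) (v : N → ℝ) : ℝ :=
  ∑ j : N, b j * v j * u ^ (j : ℕ)

/-- `B̄_𝒩(u) = ∑_{j ∉ 𝒩} b_j u^j`. -/
noncomputable def Bbar (b : ℕ → ℝ) (N : Finset ℕ) (u : ℝ) : ℝ :=
  ∑' j : ℕ, if j ∈ N then 0 else b j * u ^ j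

/-- `y = G(·, u, v)`: the function `y` maps `[0, ∞)` to `[0, 1]` and solves
`y' = B_𝒩(y, v) + B̄_𝒩(y)` with `y(0) = u`. -/
def SolvesODE (b : ℕ → ℝ) (N : Finset ℕ) (u : ℝ) (v : N → ℝ) (y : ℝ → ℝ) : Prop :=
  y 0 = u ∧ ∀ t, 0 ≤ t → y t ∈ Icc (0 : ℝ) 1 ∧
    HasDerivWithinAt y (BN b N (y t) v + Bbar b N (y t)) (Ici 0) t

/-- The finite set of all `i`-tuples of states with sum `x`. -/
def decomp {N : Finset ℕ} (i : ℕ) (x : State N) : Finset (Fin i → State N) :=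
  (Fintype.piFinset fun _ => Finset.Iic x.1 ×ˢ Finset.Iic x.2).filter fun c => ∑ m, c m = x

theorem mem_decomp {N : Finset ℕ} (i : ℕ) (x : State N) (c : Fin i → State N) :
    c ∈ decomp i x ↔ ∑ m, c m = x := by
  simp only [decomp, Finset.mem_filter, Fintype.mem_piFinset, Finset.mem_product, Finset.mem_Iic,
    and_iff_right_iff_imp]
  rintro rfl m
  exact Finset.single_le_sum (f := c) (fun a _ => zero_le (a := c a)) (Finset.mem_univ m)

/-- The `i`-th convolution `f^{*(i)}_x = ∑_{x_1 + ⋯ + x_i = x} f_{x_1} ⋯ f_{x_i}`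
(for `i = 0` it is `1` at `x = 0` and `0` elsewhere). -/
def conv {N : Finset ℕ} (f : State N → ℝ) (i : ℕ) (x : State N) : ℝ :=
  ∑ c ∈ decomp i x, ∏ m, f (c m)

/-- The same sum as in `conv`, over those tuples none of whose components equals `x`. -/
def convProper {N : Finset ℕ} (f : State N → ℝ) (i : ℕ) (x : State N) : ℝ :=
  ∑ c ∈ (decomp i x).filter (fun c => ∀ m, c m ≠ x), ∏ m, f (c m)

/-- `F_{j,k} = ∑_{i ∈ 𝒩} b_i f^{*(i)}_{j, k - e_i} + ∑_{i ∉ 𝒩} b_i ∑' f_{x_1} ⋯ f_{x_i}`, the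
inner sum over `x_1, …, x_i ≠ (j,k)` with `x_1 + ⋯ + x_i = (j,k)`. A convolution term whose
index `k - e_i` has a negative entry is zero. -/
noncomputable def recF (b : ℕ → ℝ) (N : Finset ℕ) (f : State N → ℝ) (x : State N) : ℝ :=
  (∑ i : N, if 1 ≤ x.2 i then b i * conv f i (x.1, x.2 - Pi.single i 1) else 0) +
    ∑' i : ℕ, if i ∈ N then 0 else b i * convProper f i x

end CrossingMBP

namespace CrossingMBP

/-! Attach to a function `a` on the states the formal series `A(u, v) = ∑ a_{j,k} u^j v^k`. The
forward equations become `∂_t A = B ∂_u A`, where `B(u, v) = B_𝒩(u, v) + B̄_𝒩(u)`. Since `B ∂_u` is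
a derivation, products (that is, convolutions) of solutions are again solutions (`actQ_star`).
Bounded solutions are unique (`forward_eq_zero`), so the law started from `i` particles is the
`i`-fold convolution of the law `g` started from one particle (`transition_eq_conv`).

The backward equation at a conservative state (`hasSum_backward`), applied at one particle, then
gives `g'_x = ∑ b_n g^{*(n)}`, with the second index lowered by `e_n` when `n ∈ 𝒩`. At `x = 0` this
is the autonomous equation `y' = B̄_𝒩(y)`. At `x ≠ 0`, the tuples with sum `x` that contain `x`
itself have all other entries zero, so they contribute `B̄_𝒩'(g_0) g_x`, and what is left is `F_x`.

Each `g_x` thus solves the linear equation `g_x' = F_x + B̄_𝒩'(g_0) g_x`. Because `(B̄_𝒩(g_0))' =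
B̄_𝒩'(g_0) B̄_𝒩(g_0)`, the reciprocal `1 / B̄_𝒩(g_0)` is an integrating factor once `B̄_𝒩(g_0) > 0`
is known; the barrier of `exists_barrier` supplies this and keeps `g_0` below `1`. If `0 ∈ 𝒩`, then
`g_0 = 0` and the coefficient is the constant `b_1`. -/

variable {N : Finset ℕ}

/-! ### Convolution on the state space. -/

/-- The finite set of states below `x`. -/
def below (x : State N) : Finset (State N) := Finset.Iic x.1 ×ˢ Finset.Iic x.2

theorem mem_below {x y : State N} : y ∈ below x ↔ y ≤ x := by
  rw [below, Finset.mem_product, Finset.mem_Iic, Finset.mem_Iic]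
  rfl

/-- The pairs of states with sum `x`. -/
def splits (x : State N) : Finset (State N × State N) :=
  (below x ×ˢ below x).filter fun p => p.1 + p.2 = x

theorem mem_splits {x : State N} {p : State N × State N} : p ∈ splits x ↔ p.1 + p.2 = x := by
  simp only [splits, Finset.mem_filter, Finset.mem_product, mem_below, and_iff_right_iff_imp]
  rintro rfl
  exact ⟨le_self_add, le_add_self⟩

/-- Convolution of two functions on the state space. -/
noncomputable def star (a c : State N → ℝ) (x : State N) : ℝ :=
  ∑ p ∈ splits x, a p.1 * c p.2

theorem star_comm (a c : State N → ℝ) : star a c = star c a := by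
  funext x
  refine Finset.sum_nbij' Prod.swap Prod.swap ?_ ?_ (fun _ _ => rfl) (fun _ _ => rfl)
    fun p _ => mul_comm _ _ <;>
  · intro p hp
    rw [mem_splits] at hp ⊢
    rw [← hp, add_comm]
    rfl

theorem star_assoc (a c d : State N → ℝ) : star (star a c) d = star a (star c d) := by
  funext x
  simp only [star, Finset.sum_mul, Finset.mul_sum, Finset.sum_sigma']
  apply Finset.sum_nbij' (fun ⟨⟨_i, j⟩, ⟨k, l⟩⟩ ↦ ⟨(k, l + j), (l, j)⟩)
    (fun ⟨⟨i, _j⟩, ⟨k, l⟩⟩ ↦ ⟨(i + k, l), (i, k)⟩)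
  · rintro ⟨⟨i, j⟩, ⟨k, l⟩⟩ h
    simp only [Finset.mem_sigma, mem_splits] at h ⊢
    obtain ⟨rfl, rfl⟩ := h
    simp [add_assoc]
  · rintro ⟨⟨i, j⟩, ⟨k, l⟩⟩ h
    simp only [Finset.mem_sigma, mem_splits] at h ⊢
    obtain ⟨rfl, rfl⟩ := h
    simp [add_assoc]
  · rintro ⟨⟨i, j⟩, ⟨k, l⟩⟩ h
    simp only [Finset.mem_sigma, mem_splits] at h ⊢
    obtain ⟨rfl, rfl⟩ := h
    rfl
  · rintro ⟨⟨i, j⟩, ⟨k, l⟩⟩ h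
    simp only [Finset.mem_sigma, mem_splits] at h ⊢
    obtain ⟨rfl, rfl⟩ := h
    rfl
  · rintro ⟨⟨i, j⟩, ⟨k, l⟩⟩ h
    ring

theorem add_star (a c d : State N → ℝ) :
    star (fun x => a x + c x) d = fun x => star a d x + star c d x := by
  funext x
  simp only [star, add_mul, Finset.sum_add_distrib]

/-- Summation form of the convolution over one component. -/
theorem star_eq_sum_below (a c : State N → ℝ) (x : State N) :
    star a c x = ∑ y ∈ below x, a y * c (x - y) := by
  rw [star]
  refine Finset.sum_nbij' (fun p => p.1) (fun y => (y, x - y)) ?_ ?_ ?_ ?_ ?_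
  · intro p hp
    rw [mem_splits] at hp
    exact mem_below.2 (hp ▸ le_self_add)
  · intro y hy
    rw [mem_splits]
    exact add_tsub_cancel_of_le (mem_below.1 hy)
  · rintro ⟨p, q⟩ hp
    rw [mem_splits] at hp
    subst hp
    simp
  · intro y hy
    rfl
  · rintro ⟨p, q⟩ hp
    rw [mem_splits] at hp
    subst hp
    simp

/-! ### The `Q`-matrix as a derivation. -/

/-- The increment of the augmented chain (shifted by one in the first coordinate) at a jump of
size `n - 1`. -/
def jump (N : Finset ℕ) (n : ℕ) : State N :=
  (n, if h : n ∈ N then Pi.single ⟨n, h⟩ 1 else 0)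

@[simp] theorem jump_fst (n : ℕ) : (jump N n).1 = n := rfl

theorem jump_injective : Function.Injective (jump N) := fun _ _ h => congrArg Prod.fst h

open Classical in
/-- The rates `b`, placed at the increments. -/
noncomputable def rateSeries (b : ℕ → ℝ) (N : Finset ℕ) (r : State N) : ℝ :=
  if r = jump N r.1 then b r.1 else 0

/-- Multiplication by the first coordinate. -/
def euler (a : State N → ℝ) (x : State N) : ℝ := x.1 * a x

theorem euler_star (a c : State N → ℝ) :
    euler (star a c) = fun x => star (euler a) c x + star a (euler c) x := by
  funext x
  simp only [euler, star, Finset.mul_sum, ← Finset.sum_add_distrib]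
  refine Finset.sum_congr rfl fun p hp => ?_
  rw [mem_splits] at hp
  subst hp
  push_cast [Prod.fst_add]
  ring

-- Apart from the factor `z.1`, a transition rate depends only on the increment. The shift by `(1,
-- 0)` accounts for the particle that is replaced, and keeps increments in the nonnegative cone.
open Classical in
theorem augQ_eq (b : ℕ → ℝ) (z x : State N) :
    augQ b N z x = z.1 * if z ≤ x + (1, 0) then rateSeries b N (x + (1, 0) - z) else 0 := by
  obtain ⟨i, k⟩ := z
  obtain ⟨j, l⟩ := x
  rcases Nat.eq_zero_or_pos i with rfl | hi
  · simp [augQ]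
  by_cases hij : i ≤ j + 1
  swap
  · simp [augQ, hij]
  have h1 : 1 ≤ i ∧ i ≤ j + 1 := ⟨hi, hij⟩
  simp only [augQ, h1, and_self, if_true, rateSeries, jump, Prod.ext_iff, Prod.fst_sub,
    Prod.snd_sub, add_zero, true_and, Prod.mk_le_mk, Prod.mk_add_mk]
  by_cases hn : j + 1 - i ∈ N
  · simp only [hn, dif_pos]
    by_cases hl : l = k + Pi.single ⟨j + 1 - i, hn⟩ 1
    · have hk : k ≤ l := by rw [hl]; exact le_self_add
      have : l - k = Pi.single ⟨j + 1 - i, hn⟩ 1 := by rw [hl]; simp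
      simp [hl]
    · rw [if_neg hl]
      by_cases hk : k ≤ l
      · have : ¬ (l - k = Pi.single ⟨j + 1 - i, hn⟩ 1) := fun h => hl (by
          rw [← h]; exact (add_tsub_cancel_of_le hk).symm)
        simp [hk, this]
      · simp [hk]
  · simp only [hn, dif_neg, not_false_eq_true]
    by_cases hl : l = k
    · simp [hl]
    · rw [if_neg hl]
      by_cases hk : k ≤ l
      · have : ¬ (l - k = 0) := fun h => hl (le_antisymm (tsub_eq_zero_iff_le.1 h) hk)
        simp [hk, this]
      · simp [hk]

/-- The right action of the `Q`-matrix on functions, as a finite sum. -/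
noncomputable def actQ (b : ℕ → ℝ) (N : Finset ℕ) (a : State N → ℝ) (x : State N) : ℝ :=
  ∑ z ∈ below (x + (1, 0)), a z * augQ b N z x

theorem augQ_eq_zero_of_not_le (b : ℕ → ℝ) {z x : State N} (h : ¬ z ≤ x + (1, 0)) :
    augQ b N z x = 0 := by
  rw [augQ_eq, if_neg h, mul_zero]

theorem hasSum_actQ (b : ℕ → ℝ) (a : State N → ℝ) (x : State N) :
    HasSum (fun z => a z * augQ b N z x) (actQ b N a x) := by
  refine hasSum_sum_of_ne_finset_zero fun z hz => ?_
  rw [augQ_eq_zero_of_not_le b (fun h => hz (mem_below.2 h)), mul_zero]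

/-- On series this is `B · u ∂_u A`, and evaluation at `x + (1, 0)` divides by `u`. -/
theorem actQ_eq_star (b : ℕ → ℝ) (a : State N → ℝ) (x : State N) :
    actQ b N a x = star (euler a) (rateSeries b N) (x + (1, 0)) := by
  rw [star_eq_sum_below, actQ]
  refine Finset.sum_congr rfl fun z hz => ?_
  rw [augQ_eq, if_pos (mem_below.1 hz), euler]
  ring

/-- A series divisible by `u` may be divided by `u` inside a product. -/
theorem star_shift (a c : State N → ℝ) (hc : ∀ y : State N, y.1 = 0 → c y = 0) (x : State N) :
    star a c (x + (1, 0)) = star a (fun y => c (y + (1, 0))) x := by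
  simp only [star]
  symm
  refine Finset.sum_of_injOn (fun p => (p.1, p.2 + (1, 0))) ?_ ?_ ?_ ?_
  · rintro ⟨p, q⟩ - ⟨p', q'⟩ - h
    simpa using h
  · rintro ⟨p, q⟩ h
    simp only [Finset.mem_coe, mem_splits] at h ⊢
    rw [← h, add_assoc]
  · rintro ⟨p, q⟩ h h'
    rw [mem_splits] at h
    have : q.1 = 0 := by
      by_contra hq
      refine h' ⟨(p, q - (1, 0)), ?_, ?_⟩
      · have hle : ((1, 0) : State N) ≤ q := ⟨Nat.one_le_iff_ne_zero.2 hq, fun _ => Nat.zero_le _⟩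
        simp only [Finset.mem_coe, mem_splits]
        have : p + (q - (1, 0)) + (1, 0) = x + (1, 0) := by
          rw [add_assoc, tsub_add_cancel_of_le hle, h]
        exact add_right_cancel this
      · have hle : ((1, 0) : State N) ≤ q := ⟨Nat.one_le_iff_ne_zero.2 hq, fun _ => Nat.zero_le _⟩
        simp only [tsub_add_cancel_of_le hle]
    simp [hc q this]
  · rintro ⟨p, q⟩ h
    rfl

theorem star_euler_eq_zero (a c : State N → ℝ) (y : State N) (hy : y.1 = 0) :
    star (euler a) c y = 0 := by
  refine Finset.sum_eq_zero fun p hp => ?_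
  rw [mem_splits] at hp
  have : p.1.1 = 0 := by
    have := congrArg Prod.fst hp
    rw [Prod.fst_add, hy] at this
    omega
  simp [euler, this]

/-- `actQ` is a derivation of the convolution algebra. -/
theorem actQ_star (b : ℕ → ℝ) (a c : State N → ℝ) (x : State N) :
    actQ b N (star a c) x = star (actQ b N a) c x + star a (actQ b N c) x := by
  have key : ∀ a c : State N → ℝ, star (star a (euler c)) (rateSeries b N) (x + (1, 0)) =
      star a (actQ b N c) x := by
    intro a c
    rw [star_assoc, star_shift _ _ (star_euler_eq_zero c _)]
    congr 1
    funext y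
    rw [actQ_eq_star]
  rw [actQ_eq_star, euler_star, add_star]
  beta_reduce
  rw [key, star_comm (euler a) c, key, star_comm c]

/-! ### Convolution powers. -/

/-- The empty convolution power. -/
theorem conv_zero (f : State N → ℝ) (x : State N) : conv f 0 x = if x = 0 then 1 else 0 := by
  rw [conv]
  by_cases hx : x = 0
  · have : decomp 0 x = {default} := by
      ext c
      rw [mem_decomp]
      simp [hx, Subsingleton.elim c default]
    rw [this]
    simp [hx]
  · have : decomp 0 x = ∅ := by
      ext c
      rw [mem_decomp]
      simp [Ne.symm hx]
    rw [this]
    simp [hx]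

theorem conv_succ (f : State N → ℝ) (i : ℕ) (x : State N) :
    conv f (i + 1) x = star f (conv f i) x := by
  simp only [conv, star, Finset.mul_sum]
  rw [Finset.sum_sigma']
  symm
  refine Finset.sum_nbij' (fun p => Fin.cons p.1.1 p.2)
    (fun c => ⟨(c 0, ∑ m, Fin.tail c m), Fin.tail c⟩) ?_ ?_ ?_ ?_ ?_
  · rintro ⟨⟨p, q⟩, c⟩ h
    simp only [Finset.mem_sigma, mem_splits, mem_decomp] at h ⊢
    rw [Fin.sum_univ_succ]
    simp [h.1, h.2]
  · intro c h
    simp only [Finset.mem_sigma, mem_splits, mem_decomp] at h ⊢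
    rw [Fin.sum_univ_succ] at h
    exact ⟨h, trivial⟩
  · rintro ⟨⟨p, q⟩, c⟩ h
    simp only [Finset.mem_sigma, mem_splits, mem_decomp] at h ⊢
    obtain ⟨rfl, rfl⟩ := h
    simp
  · intro c h
    simp
  · rintro ⟨⟨p, q⟩, c⟩ h
    rw [Fin.prod_univ_succ]
    simp

/-! ### Uniqueness of bounded solutions of the forward equations. -/

theorem augQ_of_ne_zero {b : ℕ → ℝ} {z x : State N} (h : augQ b N z x ≠ 0) :
    1 ≤ z.1 ∧ x + (1, 0) = z + jump N (x.1 + 1 - z.1) ∧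
      augQ b N z x = z.1 * b (x.1 + 1 - z.1) := by
  classical
  rw [augQ_eq] at h ⊢
  have hle : z ≤ x + (1, 0) := by
    by_contra hle
    simp [hle] at h
  rw [if_pos hle, rateSeries] at h ⊢
  have hj : x + (1, 0) - z = jump N (x + (1, 0) - z).1 := by
    by_contra hj
    simp at h
    exact hj h.1
  rw [if_pos hj] at h ⊢
  refine ⟨?_, ?_, rfl⟩
  · rw [Nat.one_le_iff_ne_zero]
    intro hz
    simp [hz] at h
  · have := hj ▸ (add_tsub_cancel_of_le hle).symm
    exact this

theorem augQ_diag (b : ℕ → ℝ) (h1 : 1 ∉ N) (z : State N) : augQ b N z z = z.1 * b 1 := by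
  rcases Nat.eq_zero_or_pos z.1 with h | h
  · simp [augQ, h]
  · have : z.1 + 1 - z.1 = 1 := by omega
    simp [augQ, this, h1]
    omega

theorem eq_of_add_jump_one (h1 : 1 ∉ N) {z x : State N} (h : x + (1, 0) = z + jump N 1) :
    x = z := by
  have : jump N 1 = (1, 0) := by simp [jump, h1]
  rw [this] at h
  exact add_right_cancel h

theorem augQ_nonneg {b : ℕ → ℝ} (hb : IsBranchingRates b) (h1 : 1 ∉ N) {z x : State N}
    (hzx : z ≠ x) : 0 ≤ augQ b N z x := by
  by_contra h
  obtain ⟨-, h3, h4⟩ := augQ_of_ne_zero (b := b) (z := z) (x := x) (fun h0 => h h0.ge)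
  refine h (h4 ▸ mul_nonneg (Nat.cast_nonneg _) (hb.nonneg _ fun hn => ?_))
  rw [hn] at h3
  exact hzx (eq_of_add_jump_one h1 h3).symm

/-- For `n ≥ 1`, `s ^ n ≤ s`, and the rates with `n ≠ 1` sum to `-b 1`. The set must contain `1`, so
that the only negative rate is there to compensate. -/
theorem sum_rates_mul_pow_le {b : ℕ → ℝ} (hb : IsBranchingRates b) {S : Finset ℕ} (hS : 1 ∈ S)
    {s : ℝ} (hs : 0 ≤ s) (hs1 : s ≤ 1) : ∑ n ∈ S, b n * s ^ n ≤ b 0 * (1 - s) := by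
  rw [← Finset.add_sum_erase _ _ hS]
  have hle : ∀ n ∈ S.erase 1, b n * s ^ n ≤
      (if n = 1 then 0 else b n) * s + if n = 0 then b 0 * (1 - s) else 0 := by
    intro n hn
    have hn1 := Finset.ne_of_mem_erase hn
    rcases Nat.eq_zero_or_pos n with rfl | hpos
    · simp; linarith
    · have : s ^ n ≤ s := pow_le_of_le_one hs hs1 hpos.ne'
      rw [if_neg hn1, if_neg hpos.ne', add_zero]
      exact mul_le_mul_of_nonneg_left this (hb.nonneg _ hn1)
  have h2 := Finset.sum_le_sum hle
  rw [Finset.sum_add_distrib, ← Finset.sum_mul] at h2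
  have h3 : ∑ n ∈ S.erase 1, (if n = 1 then 0 else b n) ≤ -b 1 :=
    sum_le_hasSum _ (fun n _ => by split_ifs with h; exacts [le_rfl, hb.nonneg _ h]) hb.hasSum
  have h4 : ∑ n ∈ S.erase 1, (if n = 0 then b 0 * (1 - s) else 0) ≤ b 0 * (1 - s) := by
    rw [Finset.sum_ite_eq']
    split_ifs
    · exact le_rfl
    · exact mul_nonneg (hb.nonneg 0 (by norm_num)) (by linarith)
  have h5 := mul_le_mul_of_nonneg_right h3 hs
  rw [pow_one]
  linarith

/-- The target is determined by the jump size, so the row of `z` reduces to a partial sum of the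
rates times `z.1 * s ^ (z.1 - 1)`. Membership `z ∈ A` puts the diagonal entry into this sum. -/
theorem sum_pow_mul_augQ_le {b : ℕ → ℝ} (hb : IsBranchingRates b) (h1 : 1 ∉ N)
    {A : Finset (State N)} {z : State N} (hz : z ∈ A) {s : ℝ} (hs : 0 < s) (hs1 : s ≤ 1) :
    ∑ x ∈ A, s ^ x.1 * augQ b N z x ≤ z.1 * s ^ (z.1 - 1) * (b 0 * (1 - s)) := by
  rcases Nat.eq_zero_or_pos z.1 with hz0 | hz0
  · refine le_of_eq ?_
    rw [hz0, Nat.cast_zero, zero_mul, zero_mul]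
    refine Finset.sum_eq_zero fun x _ => ?_
    simp [augQ, hz0]
  set A' := A.filter fun x => augQ b N z x ≠ 0 with hA'
  have hinj : Set.InjOn (fun x : State N => x.1 + 1 - z.1) A' := by
    intro x hx y hy hxy
    obtain ⟨-, hx2, -⟩ := augQ_of_ne_zero (Finset.mem_filter.1 hx).2
    obtain ⟨-, hy2, -⟩ := augQ_of_ne_zero (Finset.mem_filter.1 hy).2
    simp only at hxy
    rw [hxy, ← hy2] at hx2
    exact add_right_cancel hx2
  have hsum : ∑ x ∈ A, s ^ x.1 * augQ b N z x =
      z.1 * s ^ (z.1 - 1) * ∑ n ∈ A'.image (fun x : State N => x.1 + 1 - z.1), b n * s ^ n := by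
    rw [Finset.sum_image hinj, Finset.mul_sum, hA', Finset.sum_filter]
    refine Finset.sum_congr rfl fun x _ => ?_
    split_ifs with h
    · obtain ⟨h2, h3, h4⟩ := augQ_of_ne_zero h
      have h5 : x.1 + 1 = z.1 + (x.1 + 1 - z.1) := congrArg Prod.fst h3
      have h6 : x.1 = z.1 - 1 + (x.1 + 1 - z.1) := by omega
      rw [h4]
      nth_rewrite 1 [h6]
      rw [pow_add]
      ring
    · rw [not_not] at h
      rw [h, mul_zero]
  rw [hsum]
  refine mul_le_mul_of_nonneg_left (sum_rates_mul_pow_le hb ?_ hs.le hs1) (by positivity)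
  refine Finset.mem_image.2 ⟨z, ?_, by omega⟩
  rw [hA', Finset.mem_filter, augQ_diag b h1]
  have := hb.neg_one
  refine ⟨hz, mul_ne_zero (Nat.cast_ne_zero.2 hz0.ne') (by linarith)⟩

/-- At a zero of `f` the right derivative of `|f|` is `|f'|`, so the sign of `f'` serves as `σ`.
One-sided derivatives avoid the corner of the absolute value. -/
theorem hasDerivWithinAt_abs_right {f : ℝ → ℝ} {f' t : ℝ} (h : HasDerivWithinAt f f' (Ici t) t) :
    ∃ σ : ℝ, |σ| ≤ 1 ∧ σ * f t = |f t| ∧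
      HasDerivWithinAt (fun s => |f s|) (σ * f') (Ici t) t := by
  rcases lt_trichotomy (f t) 0 with h0 | h0 | h0
  · refine ⟨-1, by simp, by rw [abs_of_neg h0]; ring, ?_⟩
    exact (hasDerivAt_abs_neg h0).comp_hasDerivWithinAt t h
  · refine ⟨SignType.sign f', ?_, by simp [h0], ?_⟩
    · rcases lt_trichotomy f' 0 with h | h | h <;> simp [h]
    · rw [hasDerivWithinAt_iff_tendsto_slope] at h ⊢
      rw [sign_mul_self]
      refine h.abs.congr' ?_
      filter_upwards [self_mem_nhdsWithin] with s hs
      have hst : 0 < s - t := sub_pos.2 (lt_of_le_of_ne hs.1 (Ne.symm hs.2))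
      simp [slope_def_field, h0, abs_div, abs_of_pos hst]
  · refine ⟨1, by simp, by rw [abs_of_pos h0]; ring, ?_⟩
    exact (hasDerivAt_abs_pos h0).comp_hasDerivWithinAt t h

theorem actQ_eq_sum {b : ℕ → ℝ} (a : State N → ℝ) {x : State N} {A : Finset (State N)}
    (h : below (x + (1, 0)) ⊆ A) : actQ b N a x = ∑ z ∈ A, a z * augQ b N z x :=
  Finset.sum_subset h fun z _ hz => by
    rw [augQ_eq_zero_of_not_le b (fun h => hz (mem_below.2 h)), mul_zero]

/-- Off-diagonal entries are nonnegative, so `σ * a z ≤ |a z|` is enough there. The diagonal entry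
may be negative and needs the equality `hx`. -/
theorem sign_mul_actQ_le {b : ℕ → ℝ} (hb : IsBranchingRates b) (h1 : 1 ∉ N) (a : State N → ℝ)
    (x : State N) {σ : ℝ} (hσ : |σ| ≤ 1) (hx : σ * a x = |a x|) :
    σ * actQ b N a x ≤ actQ b N (fun z => |a z|) x := by
  rw [actQ, actQ, Finset.mul_sum]
  refine Finset.sum_le_sum fun z _ => ?_
  rw [← mul_assoc]
  by_cases hz : z = x
  · rw [hz, hx]
  · refine mul_le_mul_of_nonneg_right ?_ (augQ_nonneg hb h1 hz)
    calc σ * a z ≤ |σ * a z| := le_abs_self _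
      _ = |σ| * |a z| := abs_mul _ _
      _ ≤ 1 * |a z| := by gcongr
      _ = |a z| := one_mul _

/-- Weighted dissipativity of the `Q`-matrix on a box, up to the flux through its top level. -/
theorem sum_weighted_actQ_le {b : ℕ → ℝ} (hb : IsBranchingRates b) (h1 : 1 ∉ N)
    (a : State N → ℝ) (ha : ∀ z, 0 ≤ a z) {M : ℝ} (hM : ∀ z, a z ≤ M) (n : ℕ) (K : N → ℕ)
    {s : ℝ} (hs : 0 < s) (hs1 : s ≤ 1) :
    ∑ x ∈ below (n, K), (s ^ x.1 * actQ b N a x - a x * (x.1 * s ^ (x.1 - 1)) * (b 0 * (1 - s))) ≤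
      (Finset.Iic K).card * (M * ((n + 1) * s ^ n * (b 0 - b 1))) := by
  classical
  have hb0 : 0 ≤ b 0 := hb.nonneg 0 (by norm_num)
  have hb1 := hb.neg_one
  have hM0 : 0 ≤ M := (ha 0).trans (hM 0)
  set A := below ((n, K) : State N) with hA
  -- The first coordinate drops by at most one per jump and the second never decreases, so mass
  -- enters the box only from level `n + 1`.
  set A' := below ((n + 1, K) : State N) with hA'
  have hsub : A ⊆ A' := fun z hz => by
    rw [hA, mem_below] at hz
    rw [hA', mem_below]
    exact ⟨hz.1.trans (Nat.le_succ n), hz.2⟩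
  have hact : ∀ x ∈ A, s ^ x.1 * actQ b N a x = ∑ z ∈ A', a z * (s ^ x.1 * augQ b N z x) := by
    intro x hx
    rw [actQ_eq_sum (A := A'), Finset.mul_sum]
    · exact Finset.sum_congr rfl fun z _ => by ring
    · intro z hz
      rw [hA, mem_below] at hx
      rw [mem_below] at hz
      rw [hA', mem_below]
      refine hz.trans ⟨Nat.succ_le_succ hx.1, ?_⟩
      simpa using hx.2
  rw [Finset.sum_sub_distrib, Finset.sum_congr rfl hact, Finset.sum_comm,
    ← Finset.sum_sdiff hsub]
  have hin : ∑ z ∈ A, ∑ x ∈ A, a z * (s ^ x.1 * augQ b N z x) ≤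
      ∑ z ∈ A, a z * (z.1 * s ^ (z.1 - 1)) * (b 0 * (1 - s)) := by
    refine Finset.sum_le_sum fun z hz => ?_
    rw [← Finset.mul_sum, mul_assoc]
    exact mul_le_mul_of_nonneg_left (sum_pow_mul_augQ_le hb h1 hz hs hs1) (ha z)
  have hout : ∑ z ∈ A' \ A, ∑ x ∈ A, a z * (s ^ x.1 * augQ b N z x) ≤
      ∑ z ∈ A' \ A, M * ((n + 1) * s ^ n * (b 0 - b 1)) := by
    refine Finset.sum_le_sum fun z hz => ?_
    rw [Finset.mem_sdiff, hA', hA, mem_below, mem_below] at hz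
    have hz1 : z.1 = n + 1 := by
      refine le_antisymm hz.1.1 ?_
      by_contra h
      exact hz.2 ⟨by simpa using Nat.lt_succ_iff.1 (not_le.1 h), hz.1.2⟩
    have hzA : z ∉ A := fun h => hz.2 (mem_below.1 h)
    -- The row bound needs the diagonal, so `z` is inserted and its diagonal term is then moved to
    -- the right; this is the source of `- b 1`.
    have hrow := sum_pow_mul_augQ_le hb h1 (Finset.mem_insert_self z A) hs hs1
    rw [Finset.sum_insert hzA, augQ_diag b h1, hz1] at hrow
    rw [← Finset.mul_sum]
    have hpos : 0 ≤ ((n : ℝ) + 1) * s ^ n := by positivity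
    have h2 : ∑ x ∈ A, s ^ x.1 * augQ b N z x ≤ (n + 1) * s ^ n * (b 0 - b 1) := by
      push_cast [Nat.add_sub_cancel, pow_succ] at hrow
      have h3 := mul_nonneg hpos (mul_nonneg hb0 hs.le)
      have h4 := mul_nonneg hpos (mul_nonneg hb1.le (sub_nonneg.2 hs1))
      linarith
    calc a z * ∑ x ∈ A, s ^ x.1 * augQ b N z x
        ≤ a z * ((n + 1) * s ^ n * (b 0 - b 1)) := mul_le_mul_of_nonneg_left h2 (ha z)
      _ ≤ _ := mul_le_mul_of_nonneg_right (hM z) (mul_nonneg hpos (by linarith))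
  have hcard : (A' \ A).card ≤ (Finset.Iic K).card := by
    refine Finset.card_le_card_of_injOn Prod.snd ?_ ?_
    · intro z hz
      rw [Finset.mem_coe, Finset.mem_sdiff, hA', mem_below] at hz
      exact Finset.mem_coe.2 (Finset.mem_Iic.2 hz.1.2)
    · have hfst : ∀ z ∈ A' \ A, z.1 = n + 1 := fun z hz => by
        rw [Finset.mem_sdiff, hA', hA, mem_below, mem_below] at hz
        refine le_antisymm hz.1.1 ?_
        by_contra h
        exact hz.2 ⟨by simpa using Nat.lt_succ_iff.1 (not_le.1 h), hz.1.2⟩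
      intro z hz w hw h
      exact Prod.ext ((hfst z hz).trans (hfst w hw).symm) h
  have hout' : ∑ z ∈ A' \ A, M * ((n + 1) * s ^ n * (b 0 - b 1)) ≤
      (Finset.Iic K).card * (M * ((n + 1) * s ^ n * (b 0 - b 1))) := by
    rw [Finset.sum_const, nsmul_eq_mul]
    refine mul_le_mul_of_nonneg_right (Nat.cast_le.2 hcard) ?_
    have : 0 ≤ b 0 - b 1 := by linarith
    positivity
  linarith

/-- Bounded solutions of the forward equations are determined by their initial value. -/
theorem forward_eq_zero {b : ℕ → ℝ} (hb : IsBranchingRates b) (h1 : 1 ∉ N)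
    {φ : ℝ → State N → ℝ} {M : ℝ} (hM : ∀ t, 0 ≤ t → ∀ x, |φ t x| ≤ M) (h0 : ∀ x, φ 0 x = 0)
    (hd : ∀ t, 0 ≤ t → ∀ x, HasDerivWithinAt (fun s => φ s x) (actQ b N (φ t) x) (Ici 0) t)
    {T : ℝ} (hT : 0 ≤ T) (x₀ : State N) : φ T x₀ = 0 := by
  have hb0 : 0 ≤ b 0 := hb.nonneg 0 (by norm_num)
  have hb1 := hb.neg_one
  have hM0 : 0 ≤ M := (abs_nonneg _).trans (hM 0 le_rfl 0)
  -- The weight `s t ^ x.1` uses `s' = -(b 0 * (1 - s))`, so that its time derivative cancels the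
  -- row bound and only the flux through the top of the box remains. With this `r`, `s` stays in `[1
  -- / 2, 1 - r]` on `[0, T]`, so the flux is of order `n * (1 - r) ^ n` and vanishes as the box
  -- grows.
  set r : ℝ := Real.exp (-(b 0 * T)) / 2 with hr
  set s : ℝ → ℝ := fun t => 1 - r * Real.exp (b 0 * t) with hs
  have hr0 : 0 < r := by positivity
  have hsT : s T = 1 / 2 := by
    simp only [hs, hr]
    rw [div_mul_eq_mul_div, ← Real.exp_add]
    norm_num
  have hs_lo : ∀ t ∈ Icc 0 T, 1 / 2 ≤ s t := by
    intro t ht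
    rw [← hsT]
    change 1 - r * Real.exp (b 0 * T) ≤ 1 - r * Real.exp (b 0 * t)
    have := Real.exp_le_exp.2 (mul_le_mul_of_nonneg_left ht.2 hb0)
    nlinarith
  have hs_hi : ∀ t ∈ Icc 0 T, s t ≤ 1 - r := by
    intro t ht
    simp only [hs]
    have := Real.one_le_exp (mul_nonneg hb0 ht.1)
    nlinarith
  have hr1 : 1 - r < 1 := by linarith
  have hr2 : 0 ≤ 1 - r := by linarith [hs_lo T ⟨hT, le_rfl⟩, hs_hi T ⟨hT, le_rfl⟩]
  have hs' : ∀ t, HasDerivAt s (-(b 0 * (1 - s t))) t := by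
    intro t
    have h := ((((hasDerivAt_id t).const_mul (b 0)).exp).const_mul r).const_sub 1
    refine h.congr_deriv ?_
    simp only [hs, id]
    ring
  set ε : ℕ → ℝ := fun n => (Finset.Iic x₀.2).card * (M * ((n + 1) * (1 - r) ^ n * (b 0 - b 1)))
    with hε
  have key : ∀ n, x₀.1 ≤ n → |φ T x₀| * s T ^ x₀.1 ≤ ε n * T := by
    intro n hn
    have hright : ∀ t ∈ Ico 0 T, ∀ x : State N, ∃ σ : ℝ, |σ| ≤ 1 ∧ σ * φ t x = |φ t x| ∧
        HasDerivWithinAt (fun s => |φ s x|) (σ * actQ b N (φ t) x) (Ici t) t := fun t ht x =>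
      hasDerivWithinAt_abs_right ((hd t ht.1 x).mono (Ici_subset_Ici.2 ht.1))
    choose! σ hσ1 hσ2 hσ3 using hright
    have hcont : ∀ x, ContinuousOn (fun t => φ t x) (Icc 0 T) := fun x t ht =>
      ((hd t ht.1 x).continuousWithinAt).mono Icc_subset_Ici_self
    have hmono : ∑ x ∈ below (n, x₀.2), |φ T x| * s T ^ x.1 ≤ ε n * T := by
      refine image_le_of_deriv_right_le_deriv_boundary
        (f := fun t => ∑ x ∈ below (n, x₀.2), |φ t x| * s t ^ x.1)
        (f' := fun t => ∑ x ∈ below (n, x₀.2), (σ t x * actQ b N (φ t) x * s t ^ x.1 +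
          |φ t x| * (x.1 * s t ^ (x.1 - 1) * -(b 0 * (1 - s t)))))
        (B := fun t => ε n * t) (B' := fun _ => ε n) (a := 0) (b := T) ?_ ?_ ?_ ?_ ?_ ?_ ⟨hT, le_rfl⟩
      · refine continuousOn_finsetSum _ fun x _ => ((hcont x).abs).mul ?_
        exact ContinuousOn.pow (fun t _ => (hs' t).continuousAt.continuousWithinAt) _
      · intro t ht
        refine HasDerivWithinAt.fun_sum fun x _ => ?_
        exact (hσ3 t ht x).mul ((hs' t).pow x.1).hasDerivWithinAt
      · simp [h0]
      · fun_prop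
      · intro t _
        simpa using ((hasDerivAt_id t).const_mul (ε n)).hasDerivWithinAt
      · intro t ht
        have htI : t ∈ Icc 0 T := ⟨ht.1, ht.2.le⟩
        have hst : 0 < s t := by linarith [hs_lo t htI]
        have hst1 : s t ≤ 1 := (hs_hi t htI).trans hr1.le
        refine (Finset.sum_le_sum fun x _ => ?_).trans
          ((sum_weighted_actQ_le hb h1 (fun z => |φ t z|) (fun _ => abs_nonneg _) (hM t ht.1)
            n x₀.2 hst hst1).trans ?_)
        · have := mul_le_mul_of_nonneg_right
            (sign_mul_actQ_le hb h1 (φ t) x (hσ1 t ht x) (hσ2 t ht x)) (pow_nonneg hst.le x.1)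
          linarith
        · simp only [hε]
          have : 0 ≤ b 0 - b 1 := by linarith
          have := pow_le_pow_left₀ hst.le (hs_hi t htI) n
          gcongr
    refine le_trans ?_ hmono
    refine Finset.single_le_sum (f := fun x => |φ T x| * s T ^ x.1) (fun x _ => ?_)
      (mem_below.2 ⟨hn, le_rfl⟩)
    rw [hsT]
    positivity
  have hlim : Tendsto (fun n => ε n * T) atTop (𝓝 0) := by
    have h2 : Tendsto (fun n : ℕ => (n : ℝ) * (1 - r) ^ n) atTop (𝓝 0) :=
      tendsto_self_mul_const_pow_of_lt_one hr2 hr1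
    have h3 : Tendsto (fun n : ℕ => (1 - r) ^ n) atTop (𝓝 0) :=
      tendsto_pow_atTop_nhds_zero_of_lt_one hr2 hr1
    have h4 := (h2.add h3).const_mul ((Finset.Iic x₀.2).card * (M * (b 0 - b 1)) * T)
    rw [add_zero, mul_zero] at h4
    refine h4.congr fun n => ?_
    simp only [hε]
    ring
  have hle : |φ T x₀| * s T ^ x₀.1 ≤ 0 :=
    ge_of_tendsto hlim ((eventually_ge_atTop x₀.1).mono key)
  rw [hsT] at hle
  have hpos : (0 : ℝ) < (1 / 2) ^ x₀.1 := by positivity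
  exact abs_nonpos_iff.1 (nonpos_of_mul_nonpos_left hle hpos)

theorem actQ_sub (b : ℕ → ℝ) (a c : State N → ℝ) (x : State N) :
    actQ b N (fun z => a z - c z) x = actQ b N a x - actQ b N c x := by
  simp only [actQ, sub_mul, Finset.sum_sub_distrib]

/-! ### The branching property. -/

/-- The unit mass at a state. -/
def unitMass (u x : State N) : ℝ := if x = u then 1 else 0

theorem star_unitMass (a : State N → ℝ) (u w : State N) : star a (unitMass u) (w + u) = a w := by
  rw [star, Finset.sum_eq_single (w, u)]
  · simp [unitMass]
  · rintro ⟨p, q⟩ h hne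
    rw [mem_splits] at h
    by_cases hq : q = u
    · subst hq
      exact absurd (Prod.ext (add_right_cancel h) rfl : (p, q) = (w, q)) hne
    · simp [unitMass, hq]
  · intro h
    rw [mem_splits] at h
    exact absurd rfl h

theorem star_unitMass_of_not_le (a : State N → ℝ) {u x : State N} (h : ¬ u ≤ x) :
    star a (unitMass u) x = 0 := by
  refine Finset.sum_eq_zero fun p hp => ?_
  rw [mem_splits] at hp
  have : p.2 ≠ u := fun hu => h (by rw [← hp, hu]; exact le_add_self)
  simp [unitMass, this]

theorem unitMass_star_unitMass (v u : State N) :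
    star (unitMass v) (unitMass u) = unitMass (v + u) := by
  funext x
  by_cases h : u ≤ x
  · obtain ⟨w, rfl⟩ := exists_add_of_le h
    rw [add_comm u w, star_unitMass]
    simp [unitMass]
  · rw [star_unitMass_of_not_le _ h, unitMass, if_neg]
    rintro rfl
    exact h le_add_self

theorem hasDerivWithinAt_star {a c : ℝ → State N → ℝ} {a' c' : State N → ℝ} {S : Set ℝ} {t : ℝ}
    (ha : ∀ x, HasDerivWithinAt (fun s => a s x) (a' x) S t)
    (hc : ∀ x, HasDerivWithinAt (fun s => c s x) (c' x) S t) (x : State N) :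
    HasDerivWithinAt (fun s => star (a s) (c s) x) (star a' (c t) x + star (a t) c' x) S t := by
  simp only [star, ← Finset.sum_add_distrib]
  exact HasDerivWithinAt.fun_sum fun p _ => (ha p.1).mul (hc p.2)

theorem star_mem_Icc {a c : State N → ℝ} (ha : ∀ x, 0 ≤ a x) (hsum : HasSum a 1)
    (hc : ∀ x, c x ∈ Icc (0 : ℝ) 1) (x : State N) : star a c x ∈ Icc (0 : ℝ) 1 := by
  rw [star_eq_sum_below]
  refine ⟨Finset.sum_nonneg fun y _ => mul_nonneg (ha y) (hc _).1, ?_⟩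
  calc ∑ y ∈ below x, a y * c (x - y) ≤ ∑ y ∈ below x, a y :=
        Finset.sum_le_sum fun y _ => mul_le_of_le_one_right (ha y) (hc _).2
    _ ≤ 1 := sum_le_hasSum _ (fun y _ => ha y) hsum

theorem IsTransitionFunction.mem_Icc {α : Type} {P : ℝ → α → α → ℝ} (hP : IsTransitionFunction P)
    {t : ℝ} (ht : 0 ≤ t) (x y : α) : P t x y ∈ Icc (0 : ℝ) 1 :=
  ⟨hP.nonneg t ht x y, le_hasSum (hP.hasSum_one t ht x) y fun z _ => hP.nonneg t ht x z⟩

theorem IsTransitionFunction.zero_eq {P : ℝ → State N → State N → ℝ} (hP : IsTransitionFunction P)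
    (x : State N) : P 0 x = unitMass x := by
  funext y
  by_cases h : y = x
  · rw [h, hP.zero_diag, unitMass, if_pos rfl]
  · rw [hP.zero_offdiag x y (Ne.symm h), unitMass, if_neg h]

section Branching

variable {b : ℕ → ℝ} {P : ℝ → State N → State N → ℝ}

theorem forward_actQ (hP : IsMarkovChainWithQ (augQ b N) P) {t : ℝ} (ht : 0 ≤ t) (x y : State N) :
    HasDerivWithinAt (fun s => P s x y) (actQ b N (P t x) y) (Ici 0) t := by
  rw [← (hasSum_actQ b (P t x) y).tsum_eq]
  exact hP.forward t ht x y

/-- Two bounded solutions of the forward equations with the same initial value agree. -/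
theorem forward_unique (hb : IsBranchingRates b) (h1 : 1 ∉ N) {φ ψ : ℝ → State N → ℝ}
    (hφ : ∀ t, 0 ≤ t → ∀ x, φ t x ∈ Icc (0 : ℝ) 1) (hψ : ∀ t, 0 ≤ t → ∀ x, ψ t x ∈ Icc (0 : ℝ) 1)
    (h0 : φ 0 = ψ 0)
    (hφ' : ∀ t, 0 ≤ t → ∀ x, HasDerivWithinAt (fun s => φ s x) (actQ b N (φ t) x) (Ici 0) t)
    (hψ' : ∀ t, 0 ≤ t → ∀ x, HasDerivWithinAt (fun s => ψ s x) (actQ b N (ψ t) x) (Ici 0) t)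
    {t : ℝ} (ht : 0 ≤ t) : φ t = ψ t := by
  funext x
  refine sub_eq_zero.1 (forward_eq_zero hb h1 (φ := fun t x => φ t x - ψ t x) (M := 1)
    (fun t ht x => ?_) (fun x => by rw [h0, sub_self]) (fun t ht x => ?_) ht x)
  · have h2 := hφ t ht x
    have h3 := hψ t ht x
    rw [abs_le]
    constructor <;> linarith [h2.1, h2.2, h3.1, h3.2]
  · rw [actQ_sub]
    exact (hφ' t ht x).sub (hψ' t ht x)

/-- The row of `Q` at `(0, k)` is zero, so the constant unit mass solves the forward equations. -/
theorem transition_extinct (hb : IsBranchingRates b) (h1 : 1 ∉ N)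
    (hP : IsMarkovChainWithQ (augQ b N) P) {t : ℝ} (ht : 0 ≤ t) (k : N → ℕ) :
    P t (0, k) = unitMass (0, k) := by
  refine forward_unique hb h1 (φ := fun t => P t (0, k)) (ψ := fun _ => unitMass (0, k))
    (fun t ht => hP.mem_Icc ht _) (fun t ht x => ?_) (hP.zero_eq _)
    (fun t ht => forward_actQ hP ht _) (fun t ht x => ?_) ht
  · rw [unitMass]
    split_ifs <;> simp
  · have : actQ b N (unitMass (0, k)) x = 0 := by
      refine Finset.sum_eq_zero fun z _ => ?_
      by_cases hz : z = (0, k)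
      · simp [hz, augQ]
      · simp [unitMass, hz]
    rw [this]
    exact hasDerivWithinAt_const _ _ _

/-- By the derivation property the convolution solves the forward equations, and at time `0` it is
the unit mass at the sum of the two starting states; uniqueness does the rest. -/
theorem transition_succ (hb : IsBranchingRates b) (h1 : 1 ∉ N)
    (hP : IsMarkovChainWithQ (augQ b N) P) {t : ℝ} (ht : 0 ≤ t) (i : ℕ) (k : N → ℕ) :
    P t (i + 1, k) = star (P t (1, 0)) (P t (i, k)) := by
  refine forward_unique hb h1 (φ := fun t => P t (i + 1, k))
    (ψ := fun t => star (P t (1, 0)) (P t (i, k)))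
    (fun t ht => hP.mem_Icc ht _) (fun t ht => star_mem_Icc (hP.nonneg t ht _)
      (hP.hasSum_one t ht _) (hP.mem_Icc ht _)) ?_
    (fun t ht => forward_actQ hP ht _) (fun t ht x => ?_) ht
  · simp only [hP.zero_eq, unitMass_star_unitMass]
    simp [add_comm]
  · rw [actQ_star]
    exact hasDerivWithinAt_star (forward_actQ hP ht _) (forward_actQ hP ht _) x

/-- The branching property. -/
theorem transition_eq_conv (hb : IsBranchingRates b) (h1 : 1 ∉ N)
    (hP : IsMarkovChainWithQ (augQ b N) P) {t : ℝ} (ht : 0 ≤ t) (i : ℕ) (k : N → ℕ) :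
    P t (i, k) = star (conv (P t (1, 0)) i) (unitMass (0, k)) := by
  induction i with
  | zero =>
    have : conv (P t (1, 0)) 0 = unitMass 0 := by
      funext x
      rw [conv_zero, unitMass]
    rw [transition_extinct hb h1 hP ht, this, unitMass_star_unitMass, zero_add]
  | succ i ih =>
    have : conv (P t (1, 0)) (i + 1) = star (P t (1, 0)) (conv (P t (1, 0)) i) :=
      funext fun x => conv_succ _ _ _
    rw [transition_succ hb h1 hP ht, ih, this, star_assoc]

end Branching

/-! ### The backward equation. -/

theorem nonneg_of_hasDerivWithinAt {f : ℝ → ℝ} {D : ℝ} (h : HasDerivWithinAt f D (Ici 0) 0)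
    (h0 : f 0 = 0) (hf : ∀ t, 0 ≤ t → 0 ≤ f t) : 0 ≤ D := by
  rw [hasDerivWithinAt_iff_tendsto_slope, Ici_sdiff_left] at h
  refine ge_of_tendsto h ?_
  filter_upwards [self_mem_nhdsWithin] with t ht
  rw [slope_def_field, h0, sub_zero, sub_zero]
  exact div_nonneg (hf t (le_of_lt ht)) (le_of_lt ht)

section Backward

variable {α : Type} {Q : α → α → ℝ} {P : ℝ → α → α → ℝ}

theorem IsMarkovChainWithQ.hasDerivWithinAt_zero (hP : IsMarkovChainWithQ Q P) (x y : α) :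
    HasDerivWithinAt (fun s => P s x y) (Q x y) (Ici 0) 0 := by
  have h := hP.forward 0 le_rfl x y
  rwa [tsum_eq_single x, hP.zero_diag, one_mul] at h
  intro z hz
  rw [hP.zero_offdiag x z (Ne.symm hz), zero_mul]

/-- A Fatou-type bound: a finite part of the nonnegative series lies below `C h`, with equality at
`h = 0` because `x ∈ A`, so the derivatives at `0` are ordered. -/
theorem IsMarkovChainWithQ.sum_le_of_hasDerivWithinAt (hP : IsMarkovChainWithQ Q P) {x : α}
    {c : α → ℝ} (hc : ∀ z, 0 ≤ c z) {C : ℝ → ℝ} {D : ℝ}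
    (hC : ∀ h, 0 ≤ h → HasSum (fun z => P h x z * c z) (C h))
    (hD : HasDerivWithinAt C D (Ici 0) 0) {A : Finset α} (hx : x ∈ A) :
    ∑ z ∈ A, Q x z * c z ≤ D := by
  have hF : HasDerivWithinAt (fun h => ∑ z ∈ A, P h x z * c z) (∑ z ∈ A, Q x z * c z) (Ici 0) 0 :=
    HasDerivWithinAt.fun_sum fun z _ => (hP.hasDerivWithinAt_zero x z).mul_const _
  have h0 : ∀ z, z ≠ x → P 0 x z * c z = 0 := fun z hz => by
    rw [hP.zero_offdiag x z (Ne.symm hz), zero_mul]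
  refine sub_nonneg.1 (nonneg_of_hasDerivWithinAt (hD.sub hF) ?_ fun t ht => ?_)
  · have h3 := (hC 0 le_rfl).unique (hasSum_single x h0)
    have h4 := Finset.sum_eq_single (s := A) (f := fun z => P 0 x z * c z) x
      (fun z _ hz => h0 z hz) (fun h => absurd hx h)
    simp [h3, h4]
  · exact sub_nonneg.2 (sum_le_hasSum A
      (fun z _ => mul_nonneg (hP.nonneg t ht x z) (hc z)) (hC t ht))

/-- The backward equation at a conservative state. -/
theorem IsMarkovChainWithQ.hasSum_backward (hP : IsMarkovChainWithQ Q P) {x : α}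
    (hQ : HasSum (Q x) 0) {t : ℝ} (ht : 0 ≤ t) (y : α) {D : ℝ}
    (hD : HasDerivWithinAt (fun s => P s x y) D (Ici 0) t) :
    HasSum (fun z => Q x z * P t z y) D := by
  have hD' : HasDerivWithinAt (fun h => P (h + t) x y) D (Ici 0) 0 := by
    have h2 : HasDerivWithinAt (fun h : ℝ => h + t) 1 (Ici 0) 0 :=
      ((hasDerivAt_id (0 : ℝ)).add_const t).hasDerivWithinAt
    have h3 : HasDerivWithinAt (fun s => P s x y) D (Ici 0) (0 + t) := by rwa [zero_add]
    exact (h3.comp 0 h2 (fun h hh => add_nonneg hh ht)).congr_deriv (mul_one D)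
  have hCK : ∀ h, 0 ≤ h → HasSum (fun z => P h x z * P t z y) (P (h + t) x y) := fun h hh =>
    hP.chapman_kolmogorov h t hh ht x y
  have hsum : Summable fun z => Q x z * P t z y := by
    refine Summable.of_norm_bounded hQ.summable.norm fun z => ?_
    rw [norm_mul]
    refine mul_le_of_le_one_right (norm_nonneg _) ?_
    rw [Real.norm_of_nonneg (hP.nonneg t ht z y)]
    exact (hP.mem_Icc ht z y).2
  have hA : ∀ᶠ A : Finset α in atTop, x ∈ A := by
    filter_upwards [eventually_ge_atTop {x}] with A hA using hA (Finset.mem_singleton_self x)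
  have hlow : ∑' z, Q x z * P t z y ≤ D := by
    refine le_of_tendsto hsum.hasSum (hA.mono fun A hx => ?_)
    exact hP.sum_le_of_hasDerivWithinAt (fun z => hP.nonneg t ht z y) hCK hD' hx
  -- The reverse bound applies the same inequality to `1 - P t z y`, which is nonnegative; honesty
  -- identifies its series, and the subtracted `0` is the row sum of `Q`.
  have hup : D ≤ ∑' z, Q x z * P t z y - 0 := by
    refine ge_of_tendsto (hsum.hasSum.sub hQ) (hA.mono fun A hx => ?_)
    have h2 := hP.sum_le_of_hasDerivWithinAt (c := fun z => 1 - P t z y)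
      (C := fun h => 1 - P (h + t) x y) (D := -D)
      (fun z => sub_nonneg.2 (hP.mem_Icc ht z y).2)
      (fun h hh => by simpa [mul_sub] using (hP.hasSum_one h hh x).sub (hCK h hh))
      (hD'.const_sub 1) hx
    simp only [mul_sub, mul_one, Finset.sum_sub_distrib] at h2 ⊢
    linarith
  rw [sub_zero] at hup
  exact le_antisymm hup hlow ▸ hsum.hasSum

end Backward

/-! ### The equation for one particle and its convolution terms. -/

theorem IsBranchingRates.hasSum_zero {b : ℕ → ℝ} (hb : IsBranchingRates b) : HasSum b 0 := by
  have h := hb.hasSum.add (hasSum_ite_eq 1 (b 1))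
  rw [neg_add_cancel] at h
  refine h.congr_fun fun n => ?_
  by_cases hn : n = 1 <;> simp [hn]

theorem augQ_one_jump (b : ℕ → ℝ) (n : ℕ) : augQ b N (1, 0) (jump N n) = b n := by
  classical
  rw [augQ_eq, if_pos le_add_self, add_tsub_cancel_right, rateSeries, jump_fst, if_pos rfl]
  simp

theorem augQ_one_eq_zero (b : ℕ → ℝ) {z : State N} (hz : z ∉ range (jump N)) :
    augQ b N (1, 0) z = 0 := by
  by_contra h
  obtain ⟨-, h2, -⟩ := augQ_of_ne_zero h
  rw [add_comm (1, 0)] at h2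
  exact hz ⟨_, (add_right_cancel h2).symm⟩

theorem hasSum_one_backward {b : ℕ → ℝ} (hb : IsBranchingRates b)
    {P : ℝ → State N → State N → ℝ} (hP : IsMarkovChainWithQ (augQ b N) P) {t : ℝ} (ht : 0 ≤ t)
    (y : State N) : HasSum (fun n => b n * P t (jump N n) y) (actQ b N (P t (1, 0)) y) := by
  have hQ : HasSum (augQ b N (1, 0)) 0 := by
    rw [← jump_injective.hasSum_iff fun z hz => augQ_one_eq_zero b hz]
    exact hb.hasSum_zero.congr_fun fun n => (augQ_one_jump b n)
  have h := hP.hasSum_backward hQ ht y (forward_actQ hP ht _ y)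
  rw [← jump_injective.hasSum_iff fun z hz => by rw [augQ_one_eq_zero b hz, zero_mul]] at h
  exact h.congr_fun fun n => by simp [augQ_one_jump]

theorem le_of_mem_decomp {i : ℕ} {x : State N} {c : Fin i → State N} (hc : c ∈ decomp i x)
    (m : Fin i) : c m ≤ x := by
  rw [mem_decomp] at hc
  rw [← hc]
  exact Finset.single_le_sum (f := c) (fun a _ => zero_le (a := c a)) (Finset.mem_univ m)

theorem conv_congr {f f' : State N → ℝ} {i : ℕ} {x : State N} (h : ∀ y ≤ x, f y = f' y) :
    conv f i x = conv f' i x :=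
  Finset.sum_congr rfl fun _ hc => Finset.prod_congr rfl fun m _ => h _ (le_of_mem_decomp hc m)

theorem convProper_congr {f f' : State N → ℝ} {i : ℕ} {x : State N}
    (h : ∀ y < x, f y = f' y) : convProper f i x = convProper f' i x :=
  Finset.sum_congr rfl fun _ hc => Finset.prod_congr rfl fun m _ =>
    h _ (lt_of_le_of_ne (le_of_mem_decomp (Finset.mem_filter.1 hc).1 m)
      ((Finset.mem_filter.1 hc).2 m))

theorem sub_single_lt {x : State N} {i : N} (h : 1 ≤ x.2 i) :
    ((x.1, x.2 - Pi.single i 1) : State N) < x := by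
  refine lt_of_le_of_ne ⟨le_rfl, tsub_le_self⟩ fun heq => ?_
  have h2 := congrFun (congrArg Prod.snd heq) i
  simp only [Pi.sub_apply, Pi.single_eq_same] at h2
  omega

theorem recF_congr (b : ℕ → ℝ) {x : State N} {f f' : State N → ℝ} (h : ∀ y, y < x → f y = f' y) :
    recF b N f x = recF b N f' x := by
  rw [recF, recF]
  congr 1
  · refine Finset.sum_congr rfl fun i _ => ?_
    split_ifs with hi
    · rw [conv_congr fun y hy => h y (hy.trans_lt (sub_single_lt hi))]
    · rfl
  · refine tsum_congr fun i => ?_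
    rw [convProper_congr h]

theorem conv_at_zero (f : State N → ℝ) (i : ℕ) : conv f i 0 = f 0 ^ i := by
  have : decomp i (0 : State N) = {fun _ => 0} := by
    ext c
    rw [Finset.mem_singleton]
    refine ⟨fun hc => funext fun m => le_antisymm (le_of_mem_decomp hc m) zero_le, ?_⟩
    rintro rfl
    rw [mem_decomp]
    simp
  rw [conv, this, Finset.sum_singleton, Finset.prod_const, Finset.card_univ, Fintype.card_fin]

/-- States are nonnegative, so a tuple with sum `x` and one entry `x` vanishes elsewhere. Since `x ≠
0`, the `i` positions of that entry give distinct tuples. -/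
theorem conv_eq_convProper_add (f : State N → ℝ) (i : ℕ) {x : State N} (hx : x ≠ 0) :
    conv f i x = convProper f i x + i * f 0 ^ (i - 1) * f x := by
  classical
  rw [conv, convProper, ← Finset.sum_filter_add_sum_filter_not _ (fun c => ∀ m, c m ≠ x)]
  congr 1
  have himg : (decomp i x).filter (fun c => ¬ ∀ m, c m ≠ x) =
      Finset.univ.image fun m : Fin i => (Pi.single m x : Fin i → State N) := by
    ext c
    simp only [Finset.mem_filter, mem_decomp, not_forall, not_not, Finset.mem_image,
      Finset.mem_univ, true_and]
    constructor
    · rintro ⟨hc, m, hm⟩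
      refine ⟨m, funext fun m' => ?_⟩
      by_cases hmm : m' = m
      · subst hmm
        rw [Pi.single_eq_same, hm]
      · rw [Pi.single_eq_of_ne hmm]
        rw [← Finset.add_sum_erase _ _ (Finset.mem_univ m), hm] at hc
        have h0 : ∑ m ∈ Finset.univ.erase m, c m = 0 := add_left_cancel (hc.trans (add_zero x).symm)
        refine le_antisymm zero_le ?_
        rw [← h0]
        exact Finset.single_le_sum (f := c) (fun a _ => zero_le (a := c a))
          (Finset.mem_erase.2 ⟨hmm, Finset.mem_univ m'⟩)
    · rintro ⟨m, rfl⟩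
      exact ⟨by simp, m, Pi.single_eq_same _ _⟩
  rw [himg, Finset.sum_image fun m _ m' _ h => ?_]
  · have hprod : ∀ m : Fin i, ∏ m', f ((Pi.single m x : Fin i → State N) m') =
        f 0 ^ (i - 1) * f x := by
      intro m
      rw [← Finset.mul_prod_erase _ _ (Finset.mem_univ m), Pi.single_eq_same, mul_comm,
        Finset.prod_congr rfl fun m' hm' => by
          rw [Pi.single_eq_of_ne (Finset.ne_of_mem_erase hm')]]
      rw [Finset.prod_const, Finset.card_erase_of_mem (Finset.mem_univ m), Finset.card_univ,
        Fintype.card_fin]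
    rw [Finset.sum_congr rfl fun m _ => hprod m, Finset.sum_const, Finset.card_univ,
      Fintype.card_fin, nsmul_eq_mul, mul_assoc]
  · by_contra hne
    have := congrFun h m
    rw [Pi.single_eq_same, Pi.single_eq_of_ne hne] at this
    exact hx this

theorem convProper_nonneg {f : State N → ℝ} (hf : ∀ x, 0 ≤ f x) (i : ℕ) (x : State N) :
    0 ≤ convProper f i x :=
  Finset.sum_nonneg fun _ _ => Finset.prod_nonneg fun _ _ => hf _

theorem convProper_le_conv {f : State N → ℝ} (hf : ∀ x, 0 ≤ f x) (i : ℕ) (x : State N) :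
    convProper f i x ≤ conv f i x :=
  Finset.sum_le_sum_of_subset_of_nonneg (Finset.filter_subset _ _) fun _ _ _ =>
    Finset.prod_nonneg fun _ _ => hf _

/-- The derivative of `B̄_𝒩`. -/
noncomputable def BbarDeriv (b : ℕ → ℝ) (N : Finset ℕ) (u : ℝ) : ℝ :=
  ∑' j : ℕ, if j ∈ N then 0 else b j * (j * u ^ (j - 1))

theorem IsBranchingRates.summable_mul {b : ℕ → ℝ} (hb : IsBranchingRates b) (N : Finset ℕ)
    {a : ℕ → ℝ} (ha : ∀ n, |a n| ≤ 1) : Summable fun n => if n ∈ N then 0 else b n * a n := by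
  refine Summable.of_norm_bounded hb.hasSum_zero.summable.norm fun n => ?_
  split_ifs
  · simp
  · rw [norm_mul]
    exact mul_le_of_le_one_right (norm_nonneg _) (ha n)

theorem IsBranchingRates.norm_le {b : ℕ → ℝ} (hb : IsBranchingRates b) (n : ℕ) :
    ‖b n‖ ≤ -b 1 := by
  by_cases hn : n = 1
  · rw [hn, Real.norm_of_nonpos (by linarith [hb.neg_one])]
  · have h := le_hasSum hb.hasSum n fun j _ => by
      split_ifs with h
      exacts [le_rfl, hb.nonneg _ h]
    rw [if_neg hn] at h
    rwa [Real.norm_of_nonneg (hb.nonneg n hn)]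

theorem summable_geometric_deriv {r : ℝ} (hr : 0 ≤ r) (hr1 : r < 1) (C : ℝ) :
    Summable fun n : ℕ => C * (n * r ^ (n - 1)) := by
  refine Summable.mul_left C ?_
  rw [← summable_nat_add_iff 1]
  have h1 : Summable fun n : ℕ => (n : ℝ) * r ^ n := by
    simpa using summable_pow_mul_geometric_of_norm_lt_one 1
      (by rwa [Real.norm_of_nonneg hr] : ‖r‖ < 1)
  have h2 : Summable fun n : ℕ => r ^ n := summable_geometric_of_lt_one hr hr1
  refine (h1.add h2).congr fun n => ?_
  push_cast [Nat.add_sub_cancel]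
  ring

theorem norm_rates_mul_le {b : ℕ → ℝ} (hb : IsBranchingRates b) {r y : ℝ} (hy : |y| ≤ r) (n : ℕ) :
    ‖if n ∈ N then 0 else b n * (n * y ^ (n - 1))‖ ≤ -b 1 * (n * r ^ (n - 1)) := by
  have hr : 0 ≤ r := (abs_nonneg y).trans hy
  have hb1 := hb.neg_one
  split_ifs
  · rw [norm_zero]
    positivity
  · rw [norm_mul, norm_mul, norm_pow, RCLike.norm_natCast]
    exact mul_le_mul (hb.norm_le n) (mul_le_mul_of_nonneg_left
      (pow_le_pow_left₀ (norm_nonneg _) hy _) (Nat.cast_nonneg _)) (by positivity) hb1.le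

theorem summable_BbarDeriv {b : ℕ → ℝ} (hb : IsBranchingRates b) {y : ℝ} (hy : |y| < 1) :
    Summable fun n : ℕ => if n ∈ N then 0 else b n * (n * y ^ (n - 1)) :=
  Summable.of_norm_bounded (summable_geometric_deriv (abs_nonneg y) hy (-b 1))
    (norm_rates_mul_le hb le_rfl)

section Backward

variable {b : ℕ → ℝ} {P : ℝ → State N → State N → ℝ}

theorem conv_eq_transition (hb : IsBranchingRates b) (h1 : 1 ∉ N)
    (hP : IsMarkovChainWithQ (augQ b N) P) {t : ℝ} (ht : 0 ≤ t) (i : ℕ) (x : State N) :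
    conv (P t (1, 0)) i x = P t (i, 0) x := by
  rw [transition_eq_conv hb h1 hP ht i 0, ← star_unitMass (conv (P t (1, 0)) i) (0, 0) x]
  congr 1

theorem transition_single (hb : IsBranchingRates b) (h1 : 1 ∉ N)
    (hP : IsMarkovChainWithQ (augQ b N) P) {t : ℝ} (ht : 0 ≤ t) (n : ℕ) (i : N) (x : State N) :
    P t (n, Pi.single i 1) x =
      if 1 ≤ x.2 i then conv (P t (1, 0)) n (x.1, x.2 - Pi.single i 1) else 0 := by
  rw [transition_eq_conv hb h1 hP ht]
  split_ifs with h
  · rw [← star_unitMass (conv (P t (1, 0)) n) (0, Pi.single i 1) (x.1, x.2 - Pi.single i 1)]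
    congr 1
    refine Prod.ext rfl ?_
    refine (tsub_add_cancel_of_le ?_).symm
    intro m
    by_cases hm : m = i
    · subst hm
      simpa using h
    · simp [hm]
  · refine star_unitMass_of_not_le _ fun hle => h ?_
    simpa using hle.2 i

theorem abs_conv_le_one (hb : IsBranchingRates b) (h1 : 1 ∉ N)
    (hP : IsMarkovChainWithQ (augQ b N) P) {t : ℝ} (ht : 0 ≤ t) (i : ℕ) (x : State N) :
    |conv (P t (1, 0)) i x| ≤ 1 := by
  have := hP.mem_Icc ht (i, 0) x
  rw [conv_eq_transition hb h1 hP ht, abs_of_nonneg this.1]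
  exact this.2

theorem summable_convProper (hb : IsBranchingRates b) (h1 : 1 ∉ N)
    (hP : IsMarkovChainWithQ (augQ b N) P) {t : ℝ} (ht : 0 ≤ t) (x : State N) :
    Summable fun i : ℕ => if i ∈ N then 0 else b i * convProper (P t (1, 0)) i x := by
  refine hb.summable_mul N fun i => ?_
  have hg := hP.nonneg t ht (1, 0)
  rw [abs_of_nonneg (convProper_nonneg hg i x)]
  exact (convProper_le_conv hg i x).trans
    ((le_abs_self _).trans (abs_conv_le_one hb h1 hP ht i x))

/-- The backward equation in terms of convolutions. -/
theorem actQ_eq_conv (hb : IsBranchingRates b) (h1 : 1 ∉ N)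
    (hP : IsMarkovChainWithQ (augQ b N) P) {t : ℝ} (ht : 0 ≤ t) (x : State N) :
    actQ b N (P t (1, 0)) x =
      (∑ i : N, if 1 ≤ x.2 i then b i * conv (P t (1, 0)) i (x.1, x.2 - Pi.single i 1) else 0) +
        ∑' i : ℕ, if i ∈ N then 0 else b i * conv (P t (1, 0)) i x := by
  refine (hasSum_one_backward hb hP ht x).unique ?_
  have hfin : HasSum (fun n => if n ∈ N then b n * P t (jump N n) x else 0)
      (∑ n ∈ N, if n ∈ N then b n * P t (jump N n) x else 0) :=
    hasSum_sum_of_ne_finset_zero fun n hn => if_neg hn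
  have hinf := (hb.summable_mul N fun i => abs_conv_le_one hb h1 hP ht i x).hasSum
  have h := hfin.add hinf
  convert h using 1
  · funext n
    by_cases hn : n ∈ N
    · simp [hn]
    · simp [hn, jump, conv_eq_transition hb h1 hP ht]
  · congr 1
    rw [← Finset.sum_coe_sort N]
    refine Finset.sum_congr rfl fun i _ => ?_
    rw [if_pos i.2, jump, dif_pos i.2, transition_single hb h1 hP ht, mul_ite, mul_zero]

/-- Isolates the part linear in the unknown entry. The hypothesis `hlt` makes the series of
`BbarDeriv` summable, which may fail at `1`. -/
theorem actQ_eq_recF_add (hb : IsBranchingRates b) (h1 : 1 ∉ N)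
    (hP : IsMarkovChainWithQ (augQ b N) P) {t : ℝ} (ht : 0 ≤ t) {x : State N} (hx : x ≠ 0)
    (hlt : P t (1, 0) 0 < 1) :
    actQ b N (P t (1, 0)) x =
      recF b N (P t (1, 0)) x + BbarDeriv b N (P t (1, 0) 0) * P t (1, 0) x := by
  have h0 := hP.nonneg t ht (1, 0) 0
  rw [actQ_eq_conv hb h1 hP ht, recF, add_assoc, BbarDeriv, ← tsum_mul_right,
    ← (summable_convProper hb h1 hP ht x).tsum_add
      ((summable_BbarDeriv hb (by rwa [abs_of_nonneg h0])).mul_right _)]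
  congr 1
  refine tsum_congr fun i => ?_
  split_ifs
  · simp
  · rw [conv_eq_convProper_add _ _ hx]
    ring

theorem actQ_zero_eq_Bbar (hb : IsBranchingRates b) (h1 : 1 ∉ N)
    (hP : IsMarkovChainWithQ (augQ b N) P) {t : ℝ} (ht : 0 ≤ t) :
    actQ b N (P t (1, 0)) 0 = Bbar b N (P t (1, 0) 0) := by
  rw [actQ_eq_conv hb h1 hP ht, Bbar]
  simp [conv_at_zero]

end Backward

/-! ### Analysis of `B̄_𝒩` and of the scalar equation `y' = B̄_𝒩(y)`. -/

variable {b : ℕ → ℝ}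

theorem summable_Bbar (hb : IsBranchingRates b) {y : ℝ} (hy : |y| ≤ 1) :
    Summable fun n : ℕ => if n ∈ N then 0 else b n * y ^ n :=
  hb.summable_mul N fun n => by
    rw [abs_pow]
    exact pow_le_one₀ (abs_nonneg y) hy

theorem Bbar_zero (h0 : 0 ∉ N) : Bbar b N 0 = b 0 := by
  rw [Bbar, tsum_eq_single 0]
  · simp [h0]
  · intro n hn
    simp [hn]

theorem Bbar_one_nonpos (hb : IsBranchingRates b) (h1 : 1 ∉ N) : Bbar b N 1 ≤ 0 := by
  rw [← hb.hasSum_zero.tsum_eq, Bbar]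
  refine (summable_Bbar hb (by simp)).tsum_le_tsum (fun n => ?_) hb.hasSum_zero.summable
  split_ifs with hn
  · exact hb.nonneg n fun h => h1 (h ▸ hn)
  · simp

/-- Convexity of `B̄_𝒩` along chords issuing from the origin. -/
theorem Bbar_chord_le (hb : IsBranchingRates b) {θ q : ℝ} (hθ : 0 ≤ θ) (hθ1 : θ ≤ 1)
    (hq : 0 ≤ q) (hq1 : q ≤ 1) :
    Bbar b N (θ * q) ≤ (1 - θ) * (if 0 ∈ N then 0 else b 0) + θ * Bbar b N q := by
  have hs1 : HasSum (fun n => if n = 0 then (1 - θ) * (if 0 ∈ N then 0 else b 0) else 0)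
      ((1 - θ) * (if 0 ∈ N then 0 else b 0)) := hasSum_ite_eq 0 _
  have hs2 := ((summable_Bbar (N := N) hb (y := q) (by rwa [abs_of_nonneg hq])).hasSum).mul_left θ
  have hθq : |θ * q| ≤ 1 := by
    rw [abs_of_nonneg (mul_nonneg hθ hq)]
    exact mul_le_one₀ hθ1 hq hq1
  refine hasSum_le (fun n => ?_) (summable_Bbar hb hθq).hasSum (hs1.add hs2)
  rcases Nat.eq_zero_or_pos n with rfl | hn
  · by_cases h : 0 ∈ N
    · simp [h]
    · simp [h]
      linarith
  · by_cases h : n ∈ N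
    · simp [h, hn.ne']
    · simp only [h, hn.ne', if_false, zero_add]
      by_cases hn1 : n = 1
      · subst hn1
        rw [pow_one, pow_one]
        linarith
      · have h2 : θ ^ n ≤ θ := pow_le_of_le_one hθ hθ1 hn.ne'
        have h3 := mul_le_mul_of_nonneg_right h2 (mul_nonneg (hb.nonneg n hn1) (pow_nonneg hq n))
        rw [mul_pow]
        linarith

theorem continuousOn_Bbar (hb : IsBranchingRates b) : ContinuousOn (Bbar b N) (Icc 0 1) := by
  refine continuousOn_tsum (u := fun n => ‖b n‖) (fun n => ?_) hb.hasSum_zero.summable.norm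
    fun n y hy => ?_
  · split_ifs <;> fun_prop
  · split_ifs
    · simp
    · rw [norm_mul, norm_pow, Real.norm_of_nonneg hy.1]
      exact mul_le_of_le_one_right (norm_nonneg _) (pow_le_one₀ hy.1 hy.2)

theorem hasDerivAt_Bbar (hb : IsBranchingRates b) {y : ℝ} (hy : |y| < 1) :
    HasDerivAt (Bbar b N) (BbarDeriv b N y) y := by
  obtain ⟨r, hr, hr1⟩ := exists_between hy
  have hr0 : 0 < r := (abs_nonneg y).trans_lt hr
  refine hasDerivAt_tsum_of_isPreconnected (t := Ioo (-r) r) (y₀ := 0)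
    (summable_geometric_deriv hr0.le hr1 (-b 1)) isOpen_Ioo isPreconnected_Ioo
    (fun n z _ => ?_) (fun n z hz => norm_rates_mul_le hb (abs_le.2 ⟨hz.1.le, hz.2.le⟩) n)
    ⟨by linarith, hr0⟩ (summable_Bbar hb (by simp)) (abs_lt.1 hr)
  split_ifs
  · exact hasDerivAt_const _ _
  · exact (hasDerivAt_pow n z).const_mul (b n)

theorem continuousAt_BbarDeriv (hb : IsBranchingRates b) {y : ℝ} (hy : |y| < 1) :
    ContinuousAt (BbarDeriv b N) y := by
  obtain ⟨r, hr, hr1⟩ := exists_between hy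
  have hr0 : 0 < r := (abs_nonneg y).trans_lt hr
  have h : ContinuousOn (BbarDeriv b N) (Ioo (-r) r) := by
    refine continuousOn_tsum (fun n => ?_) (summable_geometric_deriv hr0.le hr1 (-b 1))
      fun n z hz => norm_rates_mul_le hb (abs_le.2 ⟨hz.1.le, hz.2.le⟩) n
    split_ifs <;> fun_prop
  exact h.continuousAt (isOpen_Ioo.mem_nhds (abs_lt.1 hr))

theorem exists_lipschitzOnWith_Bbar (hb : IsBranchingRates b) {r : ℝ} (hr1 : r < 1) :
    ∃ K, LipschitzOnWith K (Bbar b N) (Icc 0 r) := by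
  refine ⟨Real.toNNReal (∑' n : ℕ, -b 1 * (n * r ^ (n - 1))),
    (convex_Icc 0 r).lipschitzOnWith_of_nnnorm_hasDerivWithin_le (f' := BbarDeriv b N)
    (fun y hy => ?_) fun y hy => ?_⟩
  · refine (hasDerivAt_Bbar hb ?_).hasDerivWithinAt
    rw [abs_of_nonneg hy.1]
    exact hy.2.trans_lt hr1
  · rw [← NNReal.coe_le_coe, coe_nnnorm]
    refine le_trans ?_ (Real.le_coe_toNNReal _)
    refine tsum_of_norm_bounded
      (summable_geometric_deriv (hy.1.trans hy.2) hr1 (-b 1)).hasSum fun n => ?_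
    exact norm_rates_mul_le hb (by rw [abs_of_nonneg hy.1]; exact hy.2) n

theorem BN_zero (u : ℝ) : BN b N u 0 = 0 := by
  simp [BN]

theorem SolvesODE.hasDerivWithinAt {u : ℝ} {y : ℝ → ℝ} (hy : SolvesODE b N u 0 y) {t : ℝ}
    (ht : 0 ≤ t) : HasDerivWithinAt y (Bbar b N (y t)) (Ici 0) t := by
  have := (hy.2 t ht).2
  rwa [BN_zero, zero_add] at this

theorem SolvesODE.continuousOn {u : ℝ} {v : N → ℝ} {y : ℝ → ℝ} (hy : SolvesODE b N u v y) :
    ContinuousOn y (Ici 0) :=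
  fun t ht => (hy.2 t ht).2.continuousWithinAt

/-- All solutions starting at `0` stay below a common barrier, under which `B̄_𝒩` is positive. -/
theorem exists_barrier (hb : IsBranchingRates b) (h1 : 1 ∉ N) (h0 : 0 ∉ N) (hb0 : 0 < b 0) :
    ∃ Z : ℝ → ℝ, Monotone Z ∧ (∀ t, Z t < 1) ∧ (∀ t, ∀ s ∈ Icc 0 (Z t), 0 < Bbar b N s) ∧
      ∀ y, SolvesODE b N 0 0 y → ∀ t, 0 ≤ t → y t ≤ Z t := by
  have hclosed : IsCompact (Icc (0 : ℝ) 1 ∩ Bbar b N ⁻¹' Iic 0) :=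
    isCompact_Icc.of_isClosed_subset
      ((continuousOn_Bbar hb).preimage_isClosed_of_isClosed isClosed_Icc isClosed_Iic)
      inter_subset_left
  -- `q` is the first point of `[0, 1]` where `Bbar` is not positive. The barrier `q * (1 - exp (-(c
  -- * t)))` never reaches it.
  obtain ⟨q, ⟨hqI, hq⟩, hmin⟩ := hclosed.exists_isLeast
    ⟨1, ⟨zero_le_one, le_rfl⟩, Bbar_one_nonpos hb h1⟩
  have hq' : Bbar b N q ≤ 0 := hq
  have hq0 : 0 < q := by
    refine lt_of_le_of_ne hqI.1 fun h => ?_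
    rw [← h, Bbar_zero h0] at hq'
    linarith
  -- At a contact point, with `e = exp (-(c * t))`, the chord bound gives `Bbar ≤ b 0 * e`, while
  -- the barrier has slope `c * q * e`. The summand `1` makes the inequality strict, as the
  -- comparison theorem requires.
  set c : ℝ := b 0 / q + 1 with hc
  have hc0 : 0 < c := by positivity
  refine ⟨fun t => q * (1 - Real.exp (-(c * t))), ?_, fun t => ?_, fun t s hs => ?_, ?_⟩
  · intro t t' htt'
    have : Real.exp (-(c * t')) ≤ Real.exp (-(c * t)) :=
      Real.exp_le_exp.2 (neg_le_neg (mul_le_mul_of_nonneg_left htt' hc0.le))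
    exact mul_le_mul_of_nonneg_left (by linarith) hq0.le
  · have := mul_pos hq0 (Real.exp_pos (-(c * t)))
    simp only
    linarith [hqI.2]
  · by_contra h
    have h2 := mul_pos hq0 (Real.exp_pos (-(c * t)))
    have h3 : s < q := hs.2.trans_lt (by linarith)
    exact absurd (hmin ⟨⟨hs.1, h3.le.trans hqI.2⟩, not_lt.1 h⟩) (not_le.2 h3)
  · intro y hy T hT
    have hZ : ∀ t, HasDerivAt (fun t => q * (1 - Real.exp (-(c * t))))
        (c * (q * Real.exp (-(c * t)))) t := by
      intro t
      have h := (((((hasDerivAt_id t).const_mul c).fun_neg).exp).const_sub 1).const_mul q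
      refine h.congr_deriv ?_
      simp only [id]
      ring
    refine image_le_of_deriv_right_lt_deriv_boundary
      (hy.continuousOn.mono Icc_subset_Ici_self)
      (fun t ht => (hy.hasDerivWithinAt ht.1).mono (Ici_subset_Ici.2 ht.1)) ?_ hZ ?_ ⟨hT, le_rfl⟩
    · simp [hy.1]
    · intro t ht hyt
      have hy0 : 0 ≤ y t := (hy.2 t ht.1).1.1
      have he : 0 < Real.exp (-(c * t)) := Real.exp_pos _
      set e := Real.exp (-(c * t))
      have he1 : 0 ≤ 1 - e := by
        rw [hyt] at hy0
        exact nonneg_of_mul_nonneg_right hy0 hq0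
      rw [hyt, mul_comm q]
      have h2 := Bbar_chord_le (N := N) hb he1 (by linarith) hqI.1 hqI.2
      rw [if_neg h0] at h2
      have h3 : (1 - e) * Bbar b N q ≤ 0 := mul_nonpos_of_nonneg_of_nonpos he1 hq'
      have h4 : c * (q * e) = b 0 * e + q * e := by
        rw [hc]
        field_simp
      have h5 := mul_pos hq0 he
      linarith

/-- `Bbar` need not be Lipschitz up to `1`, but the barrier confines all solutions on `[0, t]` to an
interval `[0, Z t]` with `Z t < 1`. -/
theorem SolvesODE.unique (hb : IsBranchingRates b) (h1 : 1 ∉ N) (h0 : 0 ∉ N) (hb0 : 0 < b 0)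
    {y z : ℝ → ℝ} (hy : SolvesODE b N 0 0 y) (hz : SolvesODE b N 0 0 z) {t : ℝ} (ht : 0 ≤ t) :
    y t = z t := by
  obtain ⟨Z, hZm, hZ1, -, hZ⟩ := exists_barrier hb h1 h0 hb0
  obtain ⟨K, hK⟩ := exists_lipschitzOnWith_Bbar (N := N) hb (hZ1 t)
  have hmem : ∀ w, SolvesODE b N 0 0 w → ∀ s ∈ Ico 0 t, w s ∈ Icc 0 (Z t) := fun w hw s hs =>
    ⟨(hw.2 s hs.1).1.1, (hZ w hw s hs.1).trans (hZm hs.2.le)⟩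
  exact ODE_solution_unique_of_mem_Icc_right (v := fun _ => Bbar b N) (s := fun _ => Icc 0 (Z t))
    (fun _ _ => hK) (hy.continuousOn.mono Icc_subset_Ici_self)
    (fun s hs => (hy.hasDerivWithinAt hs.1).mono (Ici_subset_Ici.2 hs.1)) (hmem y hy)
    (hz.continuousOn.mono Icc_subset_Ici_self)
    (fun s hs => (hz.hasDerivWithinAt hs.1).mono (Ici_subset_Ici.2 hs.1)) (hmem z hz)
    (hy.1.trans hz.1.symm) ⟨ht, le_rfl⟩

/-- Without the constant term, the chord from `0` to `1` gives `Bbar y ≤ y * Bbar 1 ≤ 0`, so `y`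
cannot rise from `0`. -/
theorem SolvesODE.eq_zero (hb : IsBranchingRates b) (h1 : 1 ∉ N) (h0 : 0 ∈ N)
    {y : ℝ → ℝ} (hy : SolvesODE b N 0 0 y) {t : ℝ} (ht : 0 ≤ t) : y t = 0 := by
  refine le_antisymm ?_ (hy.2 t ht).1.1
  refine image_le_of_deriv_right_le_deriv_boundary (B := fun _ => 0) (B' := fun _ => 0)
    (hy.continuousOn.mono Icc_subset_Ici_self)
    (fun s hs => (hy.hasDerivWithinAt hs.1).mono (Ici_subset_Ici.2 hs.1)) hy.1.le
    continuousOn_const (fun _ _ => hasDerivWithinAt_const _ _ _) ?_ ⟨ht, le_rfl⟩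
  intro s hs
  have hI := (hy.2 s hs.1).1
  have h := Bbar_chord_le (N := N) hb hI.1 hI.2 zero_le_one le_rfl
  rw [if_pos h0, mul_one, mul_zero, zero_add] at h
  exact h.trans (mul_nonpos_of_nonneg_of_nonpos hI.1 (Bbar_one_nonpos hb h1))

theorem BbarDeriv_zero (h1 : 1 ∉ N) : BbarDeriv b N 0 = b 1 := by
  rw [BbarDeriv, tsum_eq_single 1]
  · simp [h1]
  · intro n hn
    rcases Nat.eq_zero_or_pos n with rfl | hpos
    · simp
    · have : n - 1 ≠ 0 := by omega
      simp [this]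

/-! ### Integration of the linear equations. -/

/-- Variation of constants for a scalar linear equation, with integrating factor `m`. -/
theorem variation_of_constants {g F a m : ℝ → ℝ}
    (hg : ∀ t, 0 ≤ t → HasDerivWithinAt g (F t + a t * g t) (Ici 0) t)
    (hm : ∀ t, 0 ≤ t → HasDerivWithinAt m (-(a t * m t)) (Ici 0) t)
    (hF : ContinuousOn F (Ici 0)) {t : ℝ} (ht : 0 ≤ t) :
    IntervalIntegrable (fun s => F s * m s) volume 0 t ∧
      g t * m t = g 0 * m 0 + ∫ s in (0 : ℝ)..t, F s * m s := by
  have hmc : ContinuousOn m (Ici 0) := fun s hs => (hm s hs).continuousWithinAt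
  have hgc : ContinuousOn g (Ici 0) := fun s hs => (hg s hs).continuousWithinAt
  have hint : IntervalIntegrable (fun s => F s * m s) volume 0 t := by
    refine ContinuousOn.intervalIntegrable ((hF.mul hmc).mono ?_)
    rw [uIcc_of_le ht]
    exact Icc_subset_Ici_self
  refine ⟨hint, ?_⟩
  have h := intervalIntegral.integral_eq_sub_of_hasDeriv_right_of_le ht
    (f := fun s => g s * m s) (f' := fun s => F s * m s)
    ((hgc.mul hmc).mono Icc_subset_Ici_self) (fun s hs => ?_) hint
  · rw [h]
    ring
  · refine (((hg s hs.1.le).mul (hm s hs.1.le)).mono ?_).congr_deriv (by ring)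
    exact (Ioi_subset_Ici_self).trans (Ici_subset_Ici.2 hs.1.le)

section Chain

variable {P : ℝ → State N → State N → ℝ}

theorem solvesODE_transition (hb : IsBranchingRates b) (h1 : 1 ∉ N)
    (hP : IsMarkovChainWithQ (augQ b N) P) : SolvesODE b N 0 0 fun t => P t (1, 0) 0 := by
  refine ⟨hP.zero_offdiag _ _ (by simp), fun t ht => ⟨hP.mem_Icc ht _ _, ?_⟩⟩
  rw [BN_zero, zero_add, ← actQ_zero_eq_Bbar hb h1 hP ht]
  exact forward_actQ hP ht _ _

theorem continuousOn_recF (hb : IsBranchingRates b) (h1 : 1 ∉ N)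
    (hP : IsMarkovChainWithQ (augQ b N) P) {x : State N} (hx : x ≠ 0)
    (hlt : ∀ t, 0 ≤ t → P t (1, 0) 0 < 1) :
    ContinuousOn (fun t => recF b N (P t (1, 0)) x) (Ici 0) := by
  have hc : ∀ z, ContinuousOn (fun t => P t (1, 0) z) (Ici 0) := fun z t ht =>
    (hP.forward t ht _ z).continuousWithinAt
  have hD : ContinuousOn (fun t => BbarDeriv b N (P t (1, 0) 0)) (Ici 0) := fun t ht =>
    ContinuousAt.comp_continuousWithinAt (f := fun t => P t (1, 0) 0) (continuousAt_BbarDeriv hb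
      (by rw [abs_of_nonneg (hP.nonneg t ht _ _)]; exact hlt t ht)) (hc 0 t ht)
  have hA : ContinuousOn (fun t => actQ b N (P t (1, 0)) x) (Ici 0) :=
    continuousOn_finsetSum _ fun z _ => (hc z).mul continuousOn_const
  -- Continuity is read off from the difference of the forward derivative, a finite sum, and the
  -- linear term, with no estimate on the series in `recF`.
  refine (hA.sub (hD.mul (hc x))).congr fun t ht => ?_
  exact eq_sub_of_add_eq (actQ_eq_recF_add hb h1 hP ht hx (hlt t ht)).symm

theorem transition_variation_of_constants (hb : IsBranchingRates b) (h1 : 1 ∉ N)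
    (hP : IsMarkovChainWithQ (augQ b N) P) {x : State N} (hx : x ≠ 0)
    (hlt : ∀ t, 0 ≤ t → P t (1, 0) 0 < 1) {m : ℝ → ℝ}
    (hm : ∀ t, 0 ≤ t →
      HasDerivWithinAt m (-(BbarDeriv b N (P t (1, 0) 0) * m t)) (Ici 0) t) {t : ℝ} (ht : 0 ≤ t) :
    IntervalIntegrable (fun s => recF b N (P s (1, 0)) x * m s) volume 0 t ∧
      P t (1, 0) x * m t = (if x = (1, 0) then 1 else 0) * m 0 +
        ∫ s in (0 : ℝ)..t, recF b N (P s (1, 0)) x * m s := by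
  have h := variation_of_constants (g := fun t => P t (1, 0) x)
    (F := fun t => recF b N (P t (1, 0)) x) (a := fun t => BbarDeriv b N (P t (1, 0) 0)) (m := m)
    (fun t ht => ?_) hm (continuousOn_recF hb h1 hP hx hlt) ht
  · rwa [hP.zero_eq] at h
  · rw [← actQ_eq_recF_add hb h1 hP ht hx (hlt t ht)]
    exact forward_actQ hP ht _ _

end Chain

end CrossingMBP

/-! ### The theorem. -/

open CrossingMBP in
theorem theorem3p2 (b : ℕ → ℝ) (hb : CrossingMBP.IsBranchingRates b)
    (N : Finset ℕ) (h1 : 1 ∉ N) (hN : ∀ k ∈ N, 0 < b k)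
    (P : ℝ → CrossingMBP.State N → CrossingMBP.State N → ℝ)
    (hP : CrossingMBP.IsMarkovChainWithQ (CrossingMBP.augQ b N) P)
    (g : ℝ → CrossingMBP.State N → ℝ) (hg : ∀ t x, g t x = P t (1, 0) x) :
    -- the series over `i ∉ 𝒩` in `F_{j,k}(t)` converges absolutely
    (∀ t, 0 ≤ t → ∀ x : CrossingMBP.State N,
      Summable (fun i : ℕ => if i ∈ N then 0 else b i * CrossingMBP.convProper (g t) i x)) ∧
    -- `F_{j,k}` involves only entries with strictly smaller index
    (∀ (x : CrossingMBP.State N) (f f' : CrossingMBP.State N → ℝ),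
      (∀ y, y < x → f y = f' y) → CrossingMBP.recF b N f x = CrossingMBP.recF b N f' x) ∧
    -- (i)
    (0 ∉ N → 0 < b 0 →
      -- `g_{00}(t) = G(t, 0, 0)`
      (CrossingMBP.SolvesODE b N 0 0 (fun t => g t (0, 0)) ∧
        ∀ y, CrossingMBP.SolvesODE b N 0 0 y → ∀ t, 0 ≤ t → g t (0, 0) = y t) ∧
      (∀ t, 0 ≤ t → 0 < CrossingMBP.Bbar b N (g t (0, 0))) ∧
      ∀ x : CrossingMBP.State N, x ≠ (0, 0) → ∀ t, 0 ≤ t →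
        IntervalIntegrable
          (fun s => CrossingMBP.recF b N (g s) x / CrossingMBP.Bbar b N (g s (0, 0)))
          MeasureTheory.volume 0 t ∧
        g t x = CrossingMBP.Bbar b N (g t (0, 0)) *
          ((if x = (1, 0) then 1 else 0) * (b 0)⁻¹ +
            ∫ s in (0 : ℝ)..t,
              CrossingMBP.recF b N (g s) x / CrossingMBP.Bbar b N (g s (0, 0)))) ∧
    -- (ii)
    (0 ∈ N →
      (∀ t, 0 ≤ t → g t (0, 0) = 0) ∧
      ∀ x : CrossingMBP.State N, x ≠ (0, 0) → ∀ t, 0 ≤ t →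
        IntervalIntegrable
          (fun s => CrossingMBP.recF b N (g s) x * Real.exp (-b 1 * s))
          MeasureTheory.volume 0 t ∧
        g t x = Real.exp (b 1 * t) *
          ((if x = (1, 0) then 1 else 0) +
            ∫ s in (0 : ℝ)..t,
              CrossingMBP.recF b N (g s) x * Real.exp (-b 1 * s))) := by
  obtain rfl : g = fun t => P t (1, 0) := funext fun t => funext fun x => hg t x
  have hode := solvesODE_transition hb h1 hP
  refine ⟨fun t ht x => summable_convProper hb h1 hP ht x,
    fun x f f' h => recF_congr b h, fun h0 hb0 => ?_, fun h0 => ?_⟩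
  · obtain ⟨Z, -, hZ1, hZpos, hZ⟩ := exists_barrier hb h1 h0 hb0
    have hlt : ∀ t, 0 ≤ t → P t (1, 0) 0 < 1 := fun t ht => (hZ _ hode t ht).trans_lt (hZ1 t)
    have hpos : ∀ t, 0 ≤ t → 0 < Bbar b N (P t (1, 0) 0) := fun t ht =>
      hZpos t _ ⟨hP.nonneg t ht _ _, hZ _ hode t ht⟩
    refine ⟨⟨hode, fun y hy t ht => hode.unique hb h1 h0 hb0 hy ht⟩, hpos, fun x hx t ht => ?_⟩
    -- The chain rule along `y' = Bbar y` makes `Bbar y` a solution of the homogeneous linear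
    -- equation, so its reciprocal is the integrating factor. Its value at time `0` is the `(b 0)⁻¹`
    -- of the formula.
    have hm : ∀ t, 0 ≤ t → HasDerivWithinAt (fun t => (Bbar b N (P t (1, 0) 0))⁻¹)
        (-(BbarDeriv b N (P t (1, 0) 0) * (Bbar b N (P t (1, 0) 0))⁻¹)) (Ici 0) t := by
      intro t ht
      have habs : |P t (1, 0) 0| < 1 := by
        rw [abs_of_nonneg (hP.nonneg t ht _ _)]
        exact hlt t ht
      have h2 : HasDerivWithinAt (fun t => Bbar b N (P t (1, 0) 0))
          (BbarDeriv b N (P t (1, 0) 0) * Bbar b N (P t (1, 0) 0)) (Ici 0) t := by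
        have h3 := (hasDerivAt_Bbar (N := N) hb habs).comp_hasDerivWithinAt t
          (hode.hasDerivWithinAt ht)
        exact h3
      refine (h2.fun_inv (hpos t ht).ne').congr_deriv ?_
      have := (hpos t ht).ne'
      field_simp
    obtain ⟨h2, h3⟩ := transition_variation_of_constants hb h1 hP hx hlt hm ht
    have h00 : P 0 (1, 0) 0 = 0 := hode.1
    rw [h00, Bbar_zero h0] at h3
    simp only [← div_eq_mul_inv] at h2 h3 ⊢
    refine ⟨h2, ?_⟩
    rw [mul_comm]
    exact (div_eq_iff (hpos t ht).ne').1 h3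
  · have hzero : ∀ t, 0 ≤ t → P t (1, 0) 0 = 0 := fun t ht => hode.eq_zero hb h1 h0 ht
    refine ⟨hzero, fun x hx t ht => ?_⟩
    have hm : ∀ t, 0 ≤ t → HasDerivWithinAt (fun t => Real.exp (-b 1 * t))
        (-(BbarDeriv b N (P t (1, 0) 0) * Real.exp (-b 1 * t))) (Ici 0) t := by
      intro t ht
      rw [hzero t ht, BbarDeriv_zero h1]
      refine (((hasDerivAt_id t).const_mul (-b 1)).exp).hasDerivWithinAt.congr_deriv ?_
      simp only [id]
      ring
    obtain ⟨h2, h3⟩ := transition_variation_of_constants hb h1 hP hx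
      (fun t ht => by rw [hzero t ht]; exact one_pos) hm ht
    refine ⟨h2, ?_⟩
    rw [mul_zero, Real.exp_zero, mul_one] at h3
    rw [← h3, mul_comm, mul_assoc, ← Real.exp_add]
    simp
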